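/- Consider the lattice $\Lambda=\mathbb{Z}^3$ with two qubits at each site. All Pauli operators are taken up to phase. Write $II, ZI, IZ, ZZ$ for the $Z$-type Pauli operators on one site, and identify them with the vectors $(0,0),(1,0),(0,1),(1,1)\in\mathbb{F}_2^2$. Each of Codes 1–4 is generated by all translates of two operators on a unit cube $\{0,1\}^3$. The $Z$-type generator acts at the corner $(a,b,c)$ by $Z_{abc}$, where | | $Z_{000}$ | $Z_{100}$ | $Z_{010}$ | $Z_{001}$ | $Z_{110}$ | $Z_{101}$ | $Z_{011}$ | $Z_{111}$ | |---|---|---|---|---|---|---|---|---| | Code 1 | $II$ | $IZ$ | $IZ$ | $IZ$ | $ZI$ | $ZI$ | $ZI$ | $ZZ$ | | Code 2 | $ZZ$ | $ZI$ | $ZI$ | $ZI$ | $ZI$ | $IZ$ | $IZ$ | $ZZ$ | | Code 3 | $II$ | $ZZ$ | $ZZ$ | $IZ$ | $ZI$ | $IZ$ | $IZ$ | $ZZ$ | | Code 4 | $II$ | $ZI$ | $IZ$ | $ZI$ | $ZI$ | $IZ$ | $IZ$ | $ZZ$ | The $X$-type generator acts at the corner $(a,b,c)$ by the $X$-type operator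 whose binary vector is that of $Z_{1-a,1-b,1-c}$ with its two entries exchanged. A *logical string segment* of width $w\ge 1$ is a triple $\zeta=(O,\Omega_1,\Omega_2)$, where $O$ is a Pauli operator of finite support and $\Omega_1,\Omega_2\subset\Lambda$ are translates of $\{0,\dots,w-1\}^3$ (the *anchors*), such that every generator that acts by the identity on both $\Omega_1$ and $\Omega_2$ commutes with $O$. Its *length* is $|a|+|b|+|c|$, where $(a,b,c)$ is the displacement between the two anchors. A *path* is a finite sequence of sites such that for any two consecutive sites some generator acts nontrivially on both. The segment $\zeta$ is *connected* if there are $p_1\in\Omega_1$ and $p_2\in\Omega_2$ joined by a path inside $\mathrm{supp}(O)\cup\{p_1,p_2\}$. Two logical string segments with the same anchors are *equivalent* if their operators differ by a finite product of generators. A logical string segment is *nontrivial* if every logical string segment equivalent to it is connected. Let $\phi(w)\in\mathbb{N}\cup\{\infty\}$ be the maximal length of the nontrivial logical string segments of width $w$. A code is *free of string logical operators* if $\phi(w)<\infty$ for every $w\ge 1$. **Theorem.** Codes 1, 2, 3 and 4 are free of string logical operators. -/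

import Mathlib

noncomputable section

namespace CubicCode

/-! # Pauli operators on the lattice, two qubits per site, modulo phases -/

/-- Sites of the infinite simple cubic lattice. -/
abbrev Site : Type := ℤ × ℤ × ℤ

/-- A two-component binary vector: which of the two qubits of a site are acted on. -/
abbrev BVec : Type := Fin 2 → ZMod 2

/-- A Pauli operator on the two qubits of one site, up to phase: the pair `(a, b)` stands for
`X^(a 0) Z^(b 0) ⊗ X^(a 1) Z^(b 1)`. Multiplication of operators is addition, the identity is `0`. -/
abbrev SitePauli : Type := BVec × BVec

/-- A finite Pauli operator on the lattice, up to phase. `O.support` is the set of sites on which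
`O` acts nontrivially. -/
abbrev PauliOp : Type := Site →₀ SitePauli

/-- The symplectic form on one site: `1` for anticommuting and `0` for commuting operators. -/
def symp (P Q : SitePauli) : ZMod 2 := P.1 ⬝ᵥ Q.2 + P.2 ⬝ᵥ Q.1

/-- Two finite Pauli operators commute. -/
def OpCommute (P Q : PauliOp) : Prop := ∑ s ∈ P.support, symp (P s) (Q s) = 0

/-! # String segments of the code given by a set `G` of stabilizer generators -/

/-- The stabilizer group: all finite products of generators. -/
def stabilizerGroup (G : Set PauliOp) : AddSubgroup PauliOp := AddSubgroup.closure G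

/-- The axis-parallel cube of `w ^ 3` sites whose least corner is `p`. -/
def cube (p : Site) (w : ℕ) : Set Site :=
  {s | (p.1 ≤ s.1 ∧ s.1 < p.1 + w) ∧ (p.2.1 ≤ s.2.1 ∧ s.2.1 < p.2.1 + w) ∧
    (p.2.2 ≤ s.2.2 ∧ s.2.2 < p.2.2 + w)}

/-- `P` acts by the identity on every site of `Ω`. -/
def ActsTriviallyOn (P : PauliOp) (Ω : Set Site) : Prop := ∀ s ∈ Ω, P s = 0

/-- A triple `(O, Ω₁, Ω₂)` of a finite Pauli operator and two congruent cubes of width `width`,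
the cubes being given by their least corners. -/
structure Segment where
  op : PauliOp
  corner₁ : Site
  corner₂ : Site
  width : ℕ

namespace Segment

/-- The first anchor. -/
def anchor₁ (ζ : Segment) : Set Site := cube ζ.corner₁ ζ.width

/-- The second anchor. -/
def anchor₂ (ζ : Segment) : Set Site := cube ζ.corner₂ ζ.width

/-- The `l₁`-length of the directional vector. -/
def length (ζ : Segment) : ℕ :=
  (ζ.corner₁.1 - ζ.corner₂.1).natAbs + (ζ.corner₁.2.1 - ζ.corner₂.2.1).natAbs +
    (ζ.corner₁.2.2 - ζ.corner₂.2.2).natAbs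

end Segment

/-- Every generator acting trivially on both anchors commutes with the operator. -/
def IsLogicalStringSegment (G : Set PauliOp) (ζ : Segment) : Prop :=
  ∀ g ∈ G, ActsTriviallyOn g ζ.anchor₁ → ActsTriviallyOn g ζ.anchor₂ → OpCommute g ζ.op

/-- Some stabilizer generator acts nontrivially on both sites simultaneously. -/
def Linked (G : Set PauliOp) (s t : Site) : Prop := ∃ g ∈ G, g s ≠ 0 ∧ g t ≠ 0

/-- `p` and `q` are joined by a path all of whose sites lie in `M`. -/
def JoinedIn (G : Set PauliOp) (M : Set Site) (p q : Site) : Prop :=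
  p ∈ M ∧ Relation.ReflTransGen (fun s t => t ∈ M ∧ Linked G s t) p q

/-- A site of one anchor and a site of the other are joined through the support of the operator. -/
def IsConnected (G : Set PauliOp) (ζ : Segment) : Prop :=
  ∃ p ∈ ζ.anchor₁, ∃ q ∈ ζ.anchor₂, JoinedIn G ((ζ.op.support : Set Site) ∪ {p, q}) p q

/-- Same anchors, and the operators differ by a finite product of generators. -/
def IsEquivalent (G : Set PauliOp) (ζ ξ : Segment) : Prop :=
  ξ.corner₁ = ζ.corner₁ ∧ ξ.corner₂ = ζ.corner₂ ∧ ξ.width = ζ.width ∧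
    ∃ s ∈ stabilizerGroup G, ξ.op = ζ.op + s

/-- Every equivalent logical string segment is connected. -/
def IsNontrivial (G : Set PauliOp) (ζ : Segment) : Prop :=
  ∀ ξ : Segment, IsLogicalStringSegment G ξ → IsEquivalent G ζ ξ → IsConnected G ξ

/-- `φ(w)`: the maximal length (possibly infinite) of the nontrivial logical string segments of
width `w`. -/
def maxLength (G : Set PauliOp) (w : ℕ) : ℕ∞ :=
  ⨆ ζ ∈ {ζ : Segment | ζ.width = w ∧ IsLogicalStringSegment G ζ ∧ IsNontrivial G ζ},
    (ζ.length : ℕ∞)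

/-- The code is free of string logical operators: `φ(w)` is finite for every width `w`. -/
def FreeOfStrings (G : Set PauliOp) : Prop := ∀ w : ℕ, 0 < w → maxLength G w < ⊤

/-! # The CSS cubic codes -/

/-- Single-site `Z`-type operators, as binary vectors. -/
abbrev II : BVec := ![0, 0]

/-- `Z` on the first qubit. -/
abbrev ZI : BVec := ![1, 0]

/-- `Z` on the second qubit. -/
abbrev IZ : BVec := ![0, 1]

/-- `Z` on both qubits. -/
abbrev ZZ : BVec := ![1, 1]

/-- The eight corner operators of a `Z`-type generator; `A'` is body-opposite to `A`, etc. -/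
structure CornerTable where
  A : BVec
  B : BVec
  C : BVec
  D : BVec
  A' : BVec
  B' : BVec
  C' : BVec
  D' : BVec

namespace CornerTable

/-- The corner operator of the `Z`-type generator at the corner `(a, b, c)` of the unit cube. -/
def zCorner (T : CornerTable) : Fin 2 → Fin 2 → Fin 2 → BVec
  | 0, 0, 0 => T.B'
  | 1, 0, 0 => T.C
  | 0, 1, 0 => T.A'
  | 0, 0, 1 => T.D'
  | 1, 1, 0 => T.D
  | 1, 0, 1 => T.A
  | 0, 1, 1 => T.C'
  | 1, 1, 1 => T.B

/-- The corner operator of the `X`-type generator: that of the `Z`-type generator at the opposite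
corner, with the two qubits exchanged. -/
def xCorner (T : CornerTable) (a b c : Fin 2) : BVec :=
  fun i => T.zCorner a.rev b.rev c.rev i.rev

/-- The `Z`-type generator on the unit cube with least corner `v`. -/
def zGen (T : CornerTable) (v : Site) : PauliOp :=
  ∑ a : Fin 2, ∑ b : Fin 2, ∑ c : Fin 2,
    Finsupp.single (v.1 + (a.val : ℤ), v.2.1 + (b.val : ℤ), v.2.2 + (c.val : ℤ))
      ((0 : BVec), T.zCorner a b c)

/-- The `X`-type generator on the unit cube with least corner `v`. -/
def xGen (T : CornerTable) (v : Site) : PauliOp :=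
  ∑ a : Fin 2, ∑ b : Fin 2, ∑ c : Fin 2,
    Finsupp.single (v.1 + (a.val : ℤ), v.2.1 + (b.val : ℤ), v.2.2 + (c.val : ℤ))
      (T.xCorner a b c, (0 : BVec))

/-- All translates of the two generators. -/
def generators (T : CornerTable) : Set PauliOp := Set.range T.zGen ∪ Set.range T.xGen

end CornerTable

/-- Code 1. -/
def code1 : CornerTable where
  A := ZI
  B := ZZ
  C := IZ
  D := ZI
  A' := IZ
  B' := II
  C' := ZI
  D' := IZ

/-- Code 2. -/
def code2 : CornerTable where
  A := IZ
  B := ZZ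
  C := ZI
  D := ZI
  A' := ZI
  B' := ZZ
  C' := IZ
  D' := ZI

/-- Code 3. -/
def code3 : CornerTable where
  A := IZ
  B := ZZ
  C := ZZ
  D := ZI
  A' := ZZ
  B' := II
  C' := IZ
  D' := IZ

/-- Code 4. -/
def code4 : CornerTable where
  A := IZ
  B := ZZ
  C := ZI
  D := ZI
  A' := IZ
  B' := II
  C' := IZ
  D' := ZI

end CubicCode

end

/-! Write `R` for the Laurent polynomial ring in x, y, z over the field with two elements, and `f`,
`g` for the two components of the `Z`-type corner table, as elements of `R`. The `Z`-part of a Pauli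
operator is a pair `(a, b)` in `R²`, its syndrome is `g a + f b`, and the `Z`-type stabilizers are
the multiples `s (f, g)`. After reflection in the origin, the `X`-part obeys the same rules with the
two components exchanged.

Three properties of `f` and `g` (`IsRigid`) rule out strings: every syzygy is a multiple of `(f,
g)`; the ideal `I = (f, g)` is prime; and `I` contains no `mono n - 1` with `n ≠ 0`. The syndrome of
a string segment is `e₁ + e₂`, each piece supported near one anchor, and the sum lies in `I`. Up to
translation there are finitely many pieces of bounded size. Two different displacements of one pair,
not both in `I`, would put `(mono d - mono d') * e₂` in `I`, which primality and aperiodicity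
forbid. So for distant anchors `e₁` and `e₂` lie in `I` separately (`IsRigid.exists_bound`), and
each is the syndrome of an operator near its own anchor. By the syzygy property the given operator
differs from the product of these two by a stabilizer, so the segment is equivalent to a
disconnected one (`freeOfStrings_of_isRigid`).

Rigidity is checked by elimination. Both components have degree one in z, say `α + zβ` and `γ + zδ`,
in either order. If the resultant `βγ - αδ` is prime in two variables, solving for z embeds `R/I` in
a field (`Eliminable.isPrime`). For aperiodicity, a zero of `f` and `g` over the dual numbers, with
a tangent direction linearly independent over the two-element field, shows that `mono n - 1 ∈ I`
forces `n` to be even; Frobenius and primality then allow `n` to be halved, and descent ends at `n =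
0`. -/

noncomputable section

namespace CubicCode

/-! ### Laurent polynomials and their evaluations -/

/-- Laurent polynomials in three variables over the field with two elements. -/
abbrev Laurent : Type := AddMonoidAlgebra (ZMod 2) Site

/-- Polynomials in two variables over the field with two elements. -/
abbrev BivPoly : Type := Polynomial (Polynomial (ZMod 2))

/-- The Laurent monomial with exponent vector `n`. -/
def mono (n : Site) : Laurent := AddMonoidAlgebra.single n 1

lemma mono_zero : mono 0 = 1 := rfl

lemma mono_add (m n : Site) : mono (m + n) = mono m * mono n := by
  simp [mono, AddMonoidAlgebra.single_mul_single]

lemma mono_mul_mono_neg (n : Site) : mono n * mono (-n) = 1 := by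
  rw [← mono_add, add_neg_cancel, mono_zero]

lemma isUnit_mono (n : Site) : IsUnit (mono n) := IsUnit.of_mul_eq_one _ (mono_mul_mono_neg n)

lemma coeff_mono_mul (n : Site) (e : Laurent) (s : Site) :
    (mono n * e).coeff s = e.coeff (s - n) := by
  rw [mono, AddMonoidAlgebra.coeff_single_mul_apply, one_mul, neg_add_eq_sub]

lemma laurent_add_self (e : Laurent) : e + e = 0 := by
  ext s; simp [CharTwo.add_self_eq_zero]

lemma laurent_neg (e : Laurent) : -e = e := neg_eq_of_add_eq_zero_left (laurent_add_self e)

lemma laurent_induction {motive : Laurent → Prop} (zero : motive 0)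
    (add : ∀ e₁ e₂, motive e₁ → motive e₂ → motive (e₁ + e₂)) (mono : ∀ n, motive (mono n))
    (e : Laurent) : motive e := by
  induction e using AddMonoidAlgebra.induction_linear with
  | zero => exact zero
  | add e₁ e₂ h₁ h₂ => exact add _ _ h₁ h₂
  | single n r =>
    have : r = 0 ∨ r = 1 := by revert r; decide
    rcases this with rfl | rfl
    · simpa using zero
    · exact mono n

section Evaluation

variable {T : Type*} [CommRing T] [Algebra (ZMod 2) T]

/-- Evaluation of Laurent polynomials at a triple of units. -/
def evalUnits (x y z : Tˣ) : Laurent →ₐ[ZMod 2] T :=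
  AddMonoidAlgebra.lift (ZMod 2) T Site
    { toFun := fun n => ((x ^ n.toAdd.1 * y ^ n.toAdd.2.1 * z ^ n.toAdd.2.2 : Tˣ) : T)
      map_one' := by simp
      map_mul' := fun m n => by
        rw [← Units.val_mul]
        congr 1
        simp only [toAdd_mul, Prod.fst_add, Prod.snd_add, zpow_add]
        simp only [mul_assoc, mul_left_comm] }

lemma evalUnits_mono (x y z : Tˣ) (n : Site) :
    evalUnits x y z (mono n) = ((x ^ n.1 * y ^ n.2.1 * z ^ n.2.2 : Tˣ) : T) := by
  simp [evalUnits, mono]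

/-- Evaluation of polynomials in two variables. -/
def evalBiv (x y : T) : BivPoly →+* T :=
  Polynomial.eval₂RingHom (Polynomial.aeval y : Polynomial (ZMod 2) →ₐ[ZMod 2] T).toRingHom x

lemma evalBiv_X (x y : T) : evalBiv x y Polynomial.X = x := by
  simp [evalBiv]

lemma evalBiv_Y (x y : T) : evalBiv x y (Polynomial.C Polynomial.X) = y := by
  simp [evalBiv]

lemma bivPoly_hom_ext {S : Type*} [CommRing S] {φ φ' : BivPoly →+* S}
    (hX : φ Polynomial.X = φ' Polynomial.X)
    (hY : φ (Polynomial.C Polynomial.X) = φ' (Polynomial.C Polynomial.X)) : φ = φ' := by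
  refine Polynomial.ringHom_ext' (Polynomial.ringHom_ext' (Subsingleton.elim _ _) hY) hX

end Evaluation

/-- The inclusion of the polynomials in the first two variables into the Laurent polynomials. -/
def incl : BivPoly →+* Laurent := evalBiv (mono (1, 0, 0)) (mono (0, 1, 0))

lemma incl_X : incl Polynomial.X = mono (1, 0, 0) := evalBiv_X _ _

lemma incl_Y : incl (Polynomial.C Polynomial.X) = mono (0, 1, 0) := evalBiv_Y _ _

/-- The product of the two variables. -/
def monoXY : BivPoly := Polynomial.X * Polynomial.C Polynomial.X

/-! ### Elimination of the third variable -/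

section Elimination

variable {I : Ideal Laurent} {t : BivPoly}

/-- Modulo `I`, the Laurent polynomial `e` is a polynomial in two variables divided by a power
of `t`. -/
def IsFractionMod (I : Ideal Laurent) (t : BivPoly) (e : Laurent) : Prop :=
  ∃ (j : ℕ) (p : BivPoly), incl t ^ j * e - incl p ∈ I

lemma IsFractionMod.add {e₁ e₂ : Laurent} (h₁ : IsFractionMod I t e₁)
    (h₂ : IsFractionMod I t e₂) : IsFractionMod I t (e₁ + e₂) := by
  obtain ⟨j₁, p₁, h₁⟩ := h₁
  obtain ⟨j₂, p₂, h₂⟩ := h₂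
  refine ⟨j₁ + j₂, t ^ j₂ * p₁ + t ^ j₁ * p₂, ?_⟩
  have := I.add_mem (I.mul_mem_left (incl t ^ j₂) h₁) (I.mul_mem_left (incl t ^ j₁) h₂)
  convert this using 1
  simp only [map_add, map_mul, map_pow]
  ring

lemma IsFractionMod.mul {e₁ e₂ : Laurent} (h₁ : IsFractionMod I t e₁)
    (h₂ : IsFractionMod I t e₂) : IsFractionMod I t (e₁ * e₂) := by
  obtain ⟨j₁, p₁, h₁⟩ := h₁
  obtain ⟨j₂, p₂, h₂⟩ := h₂
  refine ⟨j₁ + j₂, p₁ * p₂, ?_⟩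
  have := I.add_mem (I.mul_mem_left (incl t ^ j₂ * e₂) h₁) (I.mul_mem_left (incl p₁) h₂)
  convert this using 1
  simp only [map_mul]
  ring

lemma IsFractionMod.incl (p : BivPoly) : IsFractionMod I t (incl p) :=
  ⟨0, p, by simp⟩

lemma IsFractionMod.mono_zsmul {v : Site} (h : IsFractionMod I t (mono v))
    (h' : IsFractionMod I t (mono (-v))) (n : ℤ) : IsFractionMod I t (mono (n • v)) := by
  induction n using Int.induction_on with
  | zero => simpa [mono_zero] using IsFractionMod.incl (I := I) (t := t) 1
  | succ n ih => rw [add_smul, one_smul, mono_add]; exact ih.mul h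
  | pred n ih => rw [sub_smul, one_smul, sub_eq_add_neg, mono_add]; exact ih.mul h'

variable {α β : BivPoly}

/-- Modulo `I` one has zβ = -α, so multiplication by `monoXY * α * β` clears the denominators of z =
-α/β and of its inverse -β/α, as well as those of the inverses of x and y. -/
lemma isFractionMod (hI : incl α + mono (0, 0, 1) * incl β ∈ I) (e : Laurent) :
    IsFractionMod I (monoXY * α * β) e := by
  have hX : mono (1, 0, 0) * mono (-(1, 0, 0)) = 1 := mono_mul_mono_neg _
  have hY : mono (0, 1, 0) * mono (-(0, 1, 0)) = 1 := mono_mul_mono_neg _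
  have hZ : mono (0, 0, 1) * mono (-(0, 0, 1)) = 1 := mono_mul_mono_neg _
  have key : ∀ (v : Site) (p : BivPoly),
      incl (monoXY * α * β) * mono v - incl p ∈ I → IsFractionMod I (monoXY * α * β) (mono v) :=
    fun v p h => ⟨1, p, by simpa using h⟩
  have hx : ∀ n : ℤ, IsFractionMod I (monoXY * α * β) (mono (n • (1, 0, 0))) := by
    refine IsFractionMod.mono_zsmul ?_ ?_
    · simpa [incl_X] using IsFractionMod.incl (I := I) (t := monoXY * α * β) Polynomial.X
    · refine key _ (Polynomial.C Polynomial.X * α * β) ?_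
      convert I.zero_mem using 1
      simp only [map_mul, monoXY, incl_X, incl_Y]
      linear_combination (mono (0, 1, 0) * incl α * incl β) * hX
  have hy : ∀ n : ℤ, IsFractionMod I (monoXY * α * β) (mono (n • (0, 1, 0))) := by
    refine IsFractionMod.mono_zsmul ?_ ?_
    · simpa [incl_Y] using
        IsFractionMod.incl (I := I) (t := monoXY * α * β) (Polynomial.C Polynomial.X)
    · refine key _ (Polynomial.X * α * β) ?_
      convert I.zero_mem using 1
      simp only [map_mul, monoXY, incl_X, incl_Y]
      linear_combination (mono (1, 0, 0) * incl α * incl β) * hY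
  have hz : ∀ n : ℤ, IsFractionMod I (monoXY * α * β) (mono (n • (0, 0, 1))) := by
    refine IsFractionMod.mono_zsmul ?_ ?_
    · refine key _ (-(monoXY * α ^ 2)) ?_
      convert I.mul_mem_left (incl (monoXY * α)) hI using 1
      simp only [map_mul, map_neg, map_pow]
      ring
    · refine key _ (-(monoXY * β ^ 2)) ?_
      convert I.mul_mem_left (incl (monoXY * β) * mono (-(0, 0, 1))) hI using 1
      simp only [map_mul, map_neg, map_pow]
      linear_combination (-incl monoXY * incl β ^ 2) * hZ
  induction e using laurent_induction with
  | zero => simpa using IsFractionMod.incl (I := I) (t := monoXY * α * β) 0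
  | add e₁ e₂ h₁ h₂ => exact h₁.add h₂
  | mono n =>
    have : n = n.1 • ((1, 0, 0) : Site) + n.2.1 • ((0, 1, 0) : Site)
        + n.2.2 • ((0, 0, 1) : Site) := by
      ext <;> simp
    rw [this, mono_add, mono_add]
    exact ((hx _).mul (hy _)).mul (hz _)

lemma mem_of_unit_mul_mem {u e : Laurent} (hu : IsUnit u) (h : u * e ∈ I) : e ∈ I :=
  (Ideal.unit_mul_mem_iff_mem I hu).1 h

/-- The relation α = -zβ modulo `I` makes α and β associates there, so if one is a unit both are
invertible modulo `I`, and so is `monoXY * α * β`. -/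
lemma mem_of_incl_pow_mul_mem (hI : incl α + mono (0, 0, 1) * incl β ∈ I)
    (hu : IsUnit (incl α) ∨ IsUnit (incl β)) {e : Laurent} {j : ℕ}
    (h : incl (monoXY * α * β) ^ j * e ∈ I) : e ∈ I := by
  have hα : ∀ e, incl α * e ∈ I → e ∈ I := by
    intro e he
    rcases hu with hu | hu
    · exact mem_of_unit_mul_mem hu he
    · refine mem_of_unit_mul_mem ((isUnit_mono (0, 0, 1)).mul hu) ?_
      convert I.sub_mem (I.mul_mem_left e hI) he using 1
      ring
  have hβ : ∀ e, incl β * e ∈ I → e ∈ I := by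
    intro e he
    rcases hu with hu | hu
    · refine mem_of_unit_mul_mem hu ?_
      convert I.sub_mem (I.mul_mem_left e hI) (I.mul_mem_left (mono (0, 0, 1)) he) using 1
      ring
    · exact mem_of_unit_mul_mem hu he
  induction j with
  | zero => simpa using h
  | succ j ih =>
    refine ih (hβ _ (hα _ (mem_of_unit_mul_mem
      ((isUnit_mono (1, 0, 0)).mul (isUnit_mono (0, 1, 0))) ?_)))
    convert h using 1
    rw [pow_succ]
    nth_rewrite 3 [monoXY]
    simp only [map_mul, incl_X, incl_Y]
    ring

/-- A homomorphism from the polynomials in two variables to a field extends to the Laurent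
polynomials by solving `α + Zβ = 0` for the third variable. -/
lemma exists_extension {K : Type*} [Field K] [Algebra (ZMod 2) K] (φ : BivPoly →+* K)
    (ht : φ (monoXY * α * β) ≠ 0) :
    ∃ ψ : Laurent →+* K, (∀ p, ψ (incl p) = φ p) ∧
      φ α + ψ (mono (0, 0, 1)) * φ β = 0 := by
  simp only [monoXY, map_mul, ne_eq, mul_eq_zero, not_or] at ht
  obtain ⟨⟨⟨hX, hY⟩, hα⟩, hβ⟩ := ht
  refine ⟨evalUnits (Units.mk0 _ hX) (Units.mk0 _ hY)
    (Units.mk0 (-(φ α / φ β)) (neg_ne_zero.2 (div_ne_zero hα hβ))), fun p => ?_, ?_⟩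
  · refine congrArg (fun F : BivPoly →+* K => F p) (bivPoly_hom_ext (φ := RingHom.comp _ incl) ?_ ?_)
    · simp [incl_X, evalUnits_mono]
    · simp [incl_Y, evalUnits_mono]
  · simp [evalUnits_mono, hβ]

/-- Clearing denominators reduces the kernel of the extension to the kernel of `φ` on two variables.
Used for the principal ideal of `α + zβ` and for the ideal of both polynomials. -/
lemma ker_extension_le {K : Type*} [Field K] (φ : BivPoly →+* K) (ψ : Laurent →+* K)
    (hψ : ∀ p, ψ (incl p) = φ p) (hI : incl α + mono (0, 0, 1) * incl β ∈ I)
    (hu : IsUnit (incl α) ∨ IsUnit (incl β)) (hker : ∀ p, φ p = 0 → incl p ∈ I)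
    (hIψ : I ≤ RingHom.ker ψ) : RingHom.ker ψ ≤ I := by
  intro e he
  obtain ⟨j, p, hp⟩ := isFractionMod hI e
  refine mem_of_incl_pow_mul_mem hI hu (j := j) ?_
  have h0 := hIψ hp
  rw [RingHom.mem_ker] at h0 he
  rw [map_sub, map_mul, he, mul_zero, zero_sub, neg_eq_zero, hψ] at h0
  simpa using I.add_mem hp (hker p h0)

variable {γ δ : BivPoly}

/-- The data of two Laurent polynomials of degree one in the third variable, together with their
resultant `β * γ - α * δ`. -/
structure Eliminable (α β γ δ : BivPoly) : Prop where
  unit : IsUnit (incl α) ∨ IsUnit (incl β)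
  prime : Prime (β * γ - α * δ)
  not_dvd : ¬ (β * γ - α * δ) ∣ monoXY * α * β

/-- Solving for z over the fraction field of the two-variable ring gives a homomorphism to a field
with kernel generated by `α + zβ`. It does not kill `γ + zδ`, since otherwise the resultant would
vanish. -/
lemma Eliminable.dvd_of_dvd_mul (H : Eliminable α β γ δ) {a : Laurent}
    (h : incl α + mono (0, 0, 1) * incl β ∣ (incl γ + mono (0, 0, 1) * incl δ) * a) :
    incl α + mono (0, 0, 1) * incl β ∣ a := by
  set φ : BivPoly →+* FractionRing BivPoly := algebraMap _ _
  have hinj : Function.Injective φ := IsFractionRing.injective _ _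
  have ht : φ (monoXY * α * β) ≠ 0 := by
    rw [Ne, map_eq_zero_iff φ hinj]
    intro h0
    exact H.not_dvd (h0 ▸ dvd_zero _)
  obtain ⟨ψ, hψ, hZ⟩ := exists_extension φ ht
  have hle : Ideal.span {incl α + mono (0, 0, 1) * incl β} ≤ RingHom.ker ψ := by
    rw [Ideal.span_singleton_le_iff_mem, RingHom.mem_ker]
    simpa [hψ] using hZ
  have hker := ker_extension_le φ ψ hψ (Ideal.mem_span_singleton_self _) H.unit
    (fun p hp => by rw [(map_eq_zero_iff φ hinj).1 hp, map_zero]; exact Ideal.zero_mem _) hle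
  have h1 : ψ ((incl γ + mono (0, 0, 1) * incl δ) * a) = 0 :=
    hle (Ideal.mem_span_singleton.2 h)
  rw [map_mul, mul_eq_zero] at h1
  rcases h1 with h1 | h1
  · exfalso
    refine H.prime.ne_zero ((map_eq_zero_iff φ hinj).1 ?_)
    simp only [map_add, map_mul, hψ, map_sub] at h1 ⊢
    linear_combination φ β * h1 - φ δ * hZ
  · exact Ideal.mem_span_singleton.1 (hker h1)

lemma Eliminable.ne_zero (H : Eliminable α β γ δ) : incl α + mono (0, 0, 1) * incl β ≠ 0 := by
  intro h0
  set φ : BivPoly →+* FractionRing BivPoly := algebraMap _ _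
  have hinj : Function.Injective φ := IsFractionRing.injective _ _
  have hne : monoXY * α * β ≠ 0 := fun h => H.not_dvd (h ▸ dvd_zero _)
  -- Here z is sent to -xα/β instead of -α/β, so that vanishing of `α + zβ` would force (x - 1)α =
  -- 0.
  obtain ⟨ψ, hψ, hZ⟩ := exists_extension (α := Polynomial.X * α) (β := β) φ (by
    rw [Ne, map_eq_zero_iff φ hinj, mul_left_comm monoXY, mul_assoc Polynomial.X]
    exact mul_ne_zero Polynomial.X_ne_zero hne)
  have h1 := congrArg ψ h0
  simp only [map_add, map_mul, map_zero, hψ] at h1 hZ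
  have h2 : φ ((Polynomial.X - Polynomial.C 1) * α) = 0 := by
    simp only [map_sub, map_mul, map_one]
    linear_combination hZ - h1
  rw [map_eq_zero_iff φ hinj, mul_eq_zero] at h2
  rcases h2 with h2 | h2
  · exact Polynomial.X_sub_C_ne_zero _ h2
  · exact hne (by rw [h2]; ring)

lemma exists_field_hom_of_prime {B : Type} [CommRing B] {P : B} (hP : Prime P) :
    ∃ (K : Type) (_ : Field K) (φ : B →+* K), ∀ p, φ p = 0 ↔ P ∣ p := by
  have : (Ideal.span {P}).IsPrime := (Ideal.span_singleton_prime hP.ne_zero).2 hP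
  refine ⟨FractionRing (B ⧸ Ideal.span {P}), inferInstance,
    (algebraMap (B ⧸ Ideal.span {P}) _).comp (Ideal.Quotient.mk (Ideal.span {P})), fun p => ?_⟩
  rw [RingHom.comp_apply, map_eq_zero_iff _ (IsFractionRing.injective _ _),
    Ideal.Quotient.eq_zero_iff_mem, Ideal.mem_span_singleton]

lemma Eliminable.isPrime (H : Eliminable α β γ δ) :
    (Ideal.span {incl α + mono (0, 0, 1) * incl β,
      incl γ + mono (0, 0, 1) * incl δ}).IsPrime := by
  set P := β * γ - α * δ with hP
  obtain ⟨K, _, φ, hφ0⟩ := exists_field_hom_of_prime H.prime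
  let : Algebra (ZMod 2) K := (φ.comp (Polynomial.C.comp Polynomial.C)).toAlgebra
  have ht : φ (monoXY * α * β) ≠ 0 := fun h => H.not_dvd ((hφ0 _).1 h)
  have hβ : φ β ≠ 0 := fun h => ht (by rw [map_mul, h, mul_zero])
  obtain ⟨ψ, hψ, hZ⟩ := exists_extension φ ht
  set I := Ideal.span {incl α + mono (0, 0, 1) * incl β,
      incl γ + mono (0, 0, 1) * incl δ} with hI
  have hh : incl α + mono (0, 0, 1) * incl β ∈ I := Ideal.subset_span (by simp)
  have hk : incl γ + mono (0, 0, 1) * incl δ ∈ I := Ideal.subset_span (by simp)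
  have hle : I ≤ RingHom.ker ψ := by
    rw [hI, Ideal.span_le]
    rintro e (rfl | rfl)
    · simpa [RingHom.mem_ker, hψ] using hZ
    · simp only [SetLike.mem_coe, RingHom.mem_ker, map_add, map_mul, hψ]
      -- β(γ + zδ) = P + δ(α + zβ), and both terms on the right are killed.
      refine (mul_eq_zero.1 ?_).resolve_left hβ
      have hP0 := (hφ0 P).2 dvd_rfl
      simp only [hP, map_sub, map_mul] at hP0
      linear_combination hP0 + φ δ * hZ
  have hker : RingHom.ker ψ = I := by
    refine le_antisymm (ker_extension_le φ ψ hψ hh H.unit (fun p hp => ?_) hle) hle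
    obtain ⟨q, rfl⟩ := (hφ0 p).1 hp
    rw [map_mul]
    refine I.mul_mem_right _ ?_
    -- The resultant is β(γ + zδ) - δ(α + zβ), hence lies in `I`.
    convert I.sub_mem (I.mul_mem_left (incl β) hk) (I.mul_mem_left (incl δ) hh) using 1
    simp only [map_sub, map_mul]
    ring
  rw [← hker]
  exact RingHom.ker_isPrime ψ

end Elimination

/-! ### Aperiodicity and rigidity -/

/-- Descent on the l₁-norm: an even exponent `n = 2m` gives `mono n - 1 = (mono m - 1)²` in
characteristic two, and primality passes membership on to `m`. -/
lemma mono_sub_one_notMem {I : Ideal Laurent} (hI : I.IsPrime)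
    (hpar : ∀ n, mono n - 1 ∈ I → 2 ∣ n.1 ∧ 2 ∣ n.2.1 ∧ 2 ∣ n.2.2) :
    ∀ (k : ℕ) (n : Site), n.1.natAbs + n.2.1.natAbs + n.2.2.natAbs = k → n ≠ 0 →
      mono n - 1 ∉ I := by
  intro k
  induction k using Nat.strong_induction_on with
  | _ k ih =>
    rintro ⟨n₁, n₂, n₃⟩ hk hn hmem
    obtain ⟨⟨a, ha⟩, ⟨b, hb⟩, ⟨c, hc⟩⟩ := hpar _ hmem
    simp only at ha hb hc hk
    subst ha hb hc
    have hn' : ¬ (a = 0 ∧ b = 0 ∧ c = 0) := by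
      rintro ⟨rfl, rfl, rfl⟩
      exact hn rfl
    refine ih (a.natAbs + b.natAbs + c.natAbs) (by omega) (a, b, c) rfl ?_ ?_
    · intro h
      simp only [Prod.mk_eq_zero] at h
      exact hn' h
    · refine hI.mem_of_pow_mem 2 ?_
      convert hmem using 1
      have h2 : (2 * a, 2 * b, 2 * c) = ((a, b, c) + (a, b, c) : Site) := by
        simp [two_mul]
      rw [h2, mono_add]
      linear_combination laurent_add_self (1 - mono (a, b, c))

/-- The algebraic properties of the two components of the corner polynomial that exclude
string operators. -/
structure IsRigid (f g : Laurent) : Prop where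
  syzygy : ∀ a b, g * a + f * b = 0 → ∃ s, a = s * f ∧ b = s * g
  prime : (Ideal.span {f, g}).IsPrime
  aperiodic : ∀ n, n ≠ 0 → mono n - 1 ∉ Ideal.span {f, g}

lemma IsRigid.symm {f g : Laurent} (h : IsRigid f g) : IsRigid g f where
  syzygy a b hab := by
    obtain ⟨s, hb, ha⟩ := h.syzygy b a (by rw [add_comm]; exact hab)
    exact ⟨s, ha, hb⟩
  prime := by rw [Set.pair_comm]; exact h.prime
  aperiodic := by rw [Set.pair_comm]; exact h.aperiodic

lemma Eliminable.isRigid {α β γ δ : BivPoly} (H : Eliminable α β γ δ)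
    (hpar : ∀ n, mono n - 1 ∈ Ideal.span {incl α + mono (0, 0, 1) * incl β,
      incl γ + mono (0, 0, 1) * incl δ} → 2 ∣ n.1 ∧ 2 ∣ n.2.1 ∧ 2 ∣ n.2.2) :
    IsRigid (incl α + mono (0, 0, 1) * incl β) (incl γ + mono (0, 0, 1) * incl δ) where
  syzygy a b hab := by
    set h := incl α + mono (0, 0, 1) * incl β
    set k := incl γ + mono (0, 0, 1) * incl δ
    obtain ⟨s, hs⟩ : h ∣ a := H.dvd_of_dvd_mul ⟨-b, by linear_combination hab⟩
    refine ⟨s, by rw [hs, mul_comm], ?_⟩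
    have h1 : h * (k * s + b) = 0 := by rw [hs] at hab; linear_combination hab
    have h2 := (mul_eq_zero.1 h1).resolve_left H.ne_zero
    rw [← sub_eq_zero, ← h2, sub_eq_add_neg, laurent_neg]
    ring
  prime := H.isPrime
  aperiodic n hn := mono_sub_one_notMem H.isPrime hpar _ n rfl hn

/-! ### Supports and the splitting of syndromes -/

/-- The sites at sup-distance at most `r` from `c`. -/
def box (c : Site) (r : ℕ) : Set Site :=
  {s | |s.1 - c.1| ≤ r ∧ |s.2.1 - c.2.1| ≤ r ∧ |s.2.2 - c.2.2| ≤ r}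

lemma finite_box (c : Site) (r : ℕ) : (box c r).Finite := by
  refine (Set.finite_Icc (c - ((r : ℤ), (r : ℤ), (r : ℤ))) (c + ((r : ℤ), (r : ℤ), (r : ℤ)))).subset ?_
  rintro ⟨s₁, s₂, s₃⟩ ⟨h₁, h₂, h₃⟩
  simp only [abs_le] at h₁ h₂ h₃
  simp only [Set.mem_Icc, Prod.le_def, Prod.fst_sub, Prod.snd_sub, Prod.fst_add, Prod.snd_add]
  omega

lemma box_mono (c : Site) {r r' : ℕ} (h : r ≤ r') : box c r ⊆ box c r' := by
  rintro s ⟨h₁, h₂, h₃⟩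
  have : (r : ℤ) ≤ r' := by exact_mod_cast h
  exact ⟨h₁.trans this, h₂.trans this, h₃.trans this⟩

lemma sub_mem_box_iff {c s : Site} {r : ℕ} : s - c ∈ box 0 r ↔ s ∈ box c r := by
  simp [box]

/-- The coefficients of `e` vanish outside `S`. -/
def SupportedIn (e : Laurent) (S : Set Site) : Prop := ∀ s, e.coeff s ≠ 0 → s ∈ S

lemma SupportedIn.mono {e : Laurent} {S S' : Set Site} (h : SupportedIn e S) (hS : S ⊆ S') :
    SupportedIn e S' := fun s hs => hS (h s hs)

lemma SupportedIn.add {e e' : Laurent} {S : Set Site} (h : SupportedIn e S)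
    (h' : SupportedIn e' S) : SupportedIn (e + e') S := by
  intro s hs
  by_contra hn
  have h₁ := not_imp_comm.1 (h s) hn
  have h₂ := not_imp_comm.1 (h' s) hn
  simp [h₁, h₂] at hs

lemma SupportedIn.mono_mul {e : Laurent} {r : ℕ} (h : SupportedIn e (box 0 r)) (c : Site) :
    SupportedIn (CubicCode.mono c * e) (box c r) := by
  intro s hs
  rw [coeff_mono_mul] at hs
  exact sub_mem_box_iff.1 (h _ hs)

lemma exists_supportedIn_box (e : Laurent) : ∃ r, SupportedIn e (box 0 r) := by
  refine ⟨e.coeff.support.sup fun s => s.1.natAbs + s.2.1.natAbs + s.2.2.natAbs, fun s hs => ?_⟩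
  have := Finset.le_sup (f := fun s : Site => s.1.natAbs + s.2.1.natAbs + s.2.2.natAbs)
    (Finsupp.mem_support_iff.2 hs)
  simp only [box, Set.mem_ofPred_eq, Prod.fst_zero, Prod.snd_zero, sub_zero, abs_le] at this ⊢
  omega

/-- The coefficient field is finite; the uniform bounds below rest on this. -/
lemma finite_supportedIn {S : Set Site} (hS : S.Finite) : {e | SupportedIn e S}.Finite := by
  have := hS.to_subtype
  refine Set.Finite.of_finite_image (f := fun (e : Laurent) (s : S) => e.coeff s) (Set.toFinite _) ?_
  intro e he e' he' h
  ext s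
  by_cases hs : s ∈ S
  · exact congrFun h ⟨s, hs⟩
  · rw [not_imp_comm.1 (he s) hs, not_imp_comm.1 (he' s) hs]

/-- The `l₁`-norm. -/
def l1 (d : Site) : ℕ := d.1.natAbs + d.2.1.natAbs + d.2.2.natAbs

section Splitting

variable {f g : Laurent}

lemma IsRigid.eq_of_mono_mul_sub_mem (h : IsRigid f g) {e : Laurent}
    (he : e ∉ Ideal.span {f, g}) {d d' : Site}
    (hd : mono d * e - mono d' * e ∈ Ideal.span {f, g}) : d = d' := by
  by_contra hne
  have h1 : mono d' * ((mono (d - d') - 1) * e) ∈ Ideal.span {f, g} := by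
    convert hd using 1
    rw [← mul_assoc, mul_sub, ← mono_add, add_sub_cancel]
    ring
  rcases h.prime.mem_or_mem (mem_of_unit_mul_mem (isUnit_mono d') h1) with h2 | h2
  · exact h.aperiodic _ (sub_ne_zero.2 hne) h2
  · exact he h2

/-- For each of the finitely many pairs `(e₁, e₂)` not both in the ideal, at most one displacement
`d` is possible, so `N` can be taken to bound all these exceptional displacements. -/
lemma IsRigid.exists_bound (h : IsRigid f g) (ρ : ℕ) :
    ∃ N, ∀ e₁ e₂ d, SupportedIn e₁ (box 0 ρ) → SupportedIn e₂ (box 0 ρ) →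
      e₁ + mono d * e₂ ∈ Ideal.span {f, g} → N < l1 d →
      e₁ ∈ Ideal.span {f, g} ∧ e₂ ∈ Ideal.span {f, g} := by
  set I := Ideal.span {f, g}
  set V := {e | SupportedIn e (box 0 ρ)}
  have hV : V.Finite := finite_supportedIn (finite_box 0 ρ)
  have hfin : (⋃ e₁ ∈ V, ⋃ e₂ ∈ V,
      {d | e₁ + mono d * e₂ ∈ I ∧ ¬ (e₁ ∈ I ∧ e₂ ∈ I)}).Finite := by
    refine hV.biUnion fun e₁ _ => hV.biUnion fun e₂ _ => Set.Subsingleton.finite ?_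
    rintro d ⟨hd, hn⟩ d' ⟨hd', -⟩
    refine h.eq_of_mono_mul_sub_mem (e := e₂) (fun he₂ => hn ⟨?_, he₂⟩) ?_
    · convert I.sub_mem hd (I.mul_mem_left (mono d) he₂) using 1
      ring
    · convert I.sub_mem hd hd' using 1
      ring
  obtain ⟨N, hN⟩ := (hfin.image l1).bddAbove
  refine ⟨N, fun e₁ e₂ d h₁ h₂ hd hl => ?_⟩
  by_contra hn
  refine hl.not_ge (hN ⟨d, ?_, rfl⟩)
  simp only [Set.mem_iUnion]
  exact ⟨e₁, h₁, e₂, h₂, hd, hn⟩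

lemma exists_bounded_preimage (f g : Laurent) (ρ : ℕ) :
    ∃ r, ∀ e, SupportedIn e (box 0 ρ) → e ∈ Ideal.span {f, g} →
      ∃ a b, g * a + f * b = e ∧ SupportedIn a (box 0 r) ∧ SupportedIn b (box 0 r) := by
  have : ∀ e, ∃ r, e ∈ Ideal.span {f, g} →
      ∃ a b, g * a + f * b = e ∧ SupportedIn a (box 0 r) ∧ SupportedIn b (box 0 r) := by
    intro e
    by_cases he : e ∈ Ideal.span {f, g}
    · obtain ⟨b, a, hab⟩ := Ideal.mem_span_pair.1 he
      obtain ⟨r₁, h₁⟩ := exists_supportedIn_box a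
      obtain ⟨r₂, h₂⟩ := exists_supportedIn_box b
      exact ⟨max r₁ r₂, fun _ => ⟨a, b, by rw [← hab]; ring,
        h₁.mono (box_mono _ (le_max_left _ _)), h₂.mono (box_mono _ (le_max_right _ _))⟩⟩
    · exact ⟨0, fun h => absurd h he⟩
  choose R hR using this
  obtain ⟨r, hr⟩ := ((finite_supportedIn (finite_box 0 ρ)).image R).bddAbove
  refine ⟨r, fun e he heI => ?_⟩
  obtain ⟨a, b, hab, ha, hb⟩ := hR e heI
  have hle : R e ≤ r := hr ⟨e, he, rfl⟩
  exact ⟨a, b, hab, ha.mono (box_mono _ hle), hb.mono (box_mono _ hle)⟩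

lemma exists_split {e : Laurent} {S₁ S₂ : Set Site} (he : SupportedIn e (S₁ ∪ S₂)) :
    ∃ e₁ e₂, e = e₁ + e₂ ∧ SupportedIn e₁ S₁ ∧ SupportedIn e₂ S₂ := by
  classical
  refine ⟨.ofCoeff (e.coeff.filter (· ∈ S₁)), .ofCoeff (e.coeff.filter (· ∉ S₁)), ?_, ?_, ?_⟩
  · rw [← AddMonoidAlgebra.ofCoeff_add, Finsupp.filter_add_filter_not]
  · intro s hs
    by_contra hn
    simp [hn] at hs
  · intro s hs
    simp only [Finsupp.filter_apply, ne_eq, ite_eq_right_iff, Classical.not_imp] at hs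
    exact (he s hs.2).resolve_left hs.1

/-- If the syndrome of `(a, b)` is supported near two distant sites, then so is `(a, b)` itself,
up to a multiple of `(f, g)`. -/
theorem IsRigid.exists_supportedIn (h : IsRigid f g) (ρ : ℕ) :
    ∃ N r, ∀ (c₁ c₂ : Site) (a b : Laurent), N < l1 (c₂ - c₁) →
      SupportedIn (g * a + f * b) (box c₁ ρ ∪ box c₂ ρ) →
      ∃ s, SupportedIn (a + s * f) (box c₁ r ∪ box c₂ r) ∧
        SupportedIn (b + s * g) (box c₁ r ∪ box c₂ r) := by
  obtain ⟨N, hN⟩ := h.exists_bound ρ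
  obtain ⟨r, hr⟩ := exists_bounded_preimage f g ρ
  refine ⟨N, r, fun c₁ c₂ a b hl hab => ?_⟩
  obtain ⟨e₁, e₂, he, h₁, h₂⟩ := exists_split hab
  have hshift : ∀ {e : Laurent} {c : Site}, SupportedIn e (box c ρ) →
      SupportedIn (mono (-c) * e) (box 0 ρ) := by
    intro e c he s hs
    rw [coeff_mono_mul, sub_neg_eq_add] at hs
    simpa using sub_mem_box_iff.2 (he _ hs)
  have hback : ∀ (e : Laurent) (c : Site), mono c * (mono (-c) * e) = e := fun e c => by
    rw [← mul_assoc, mono_mul_mono_neg, one_mul]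
  -- Both pieces are moved to the origin; multiplying the whole syndrome by `mono (-c₁)` leaves the
  -- displacement `c₂ - c₁` between them.
  obtain ⟨hI₁, hI₂⟩ := hN _ _ (c₂ - c₁) (hshift h₁) (hshift h₂) (by
    have : mono (-c₁) * (g * a + f * b) ∈ Ideal.span {f, g} :=
      Ideal.mul_mem_left _ _ (Ideal.mem_span_pair.2 ⟨b, a, by ring⟩)
    convert this using 1
    rw [he, ← mul_assoc, ← mono_add, mul_add]
    congr 3
    abel) hl
  obtain ⟨a₁, b₁, hab₁, ha₁, hb₁⟩ := hr _ (hshift h₁) hI₁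
  obtain ⟨a₂, b₂, hab₂, ha₂, hb₂⟩ := hr _ (hshift h₂) hI₂
  -- The local preimages have the same total syndrome as `(a, b)`, so the difference is a syzygy.
  obtain ⟨s, hs, hs'⟩ := h.syzygy (a - (mono c₁ * a₁ + mono c₂ * a₂))
    (b - (mono c₁ * b₁ + mono c₂ * b₂)) (by
      rw [← hback e₁ c₁, ← hback e₂ c₂] at he
      linear_combination he - mono c₁ * hab₁ - mono c₂ * hab₂)
  have hsupp : ∀ {p q : Laurent}, SupportedIn p (box 0 r) → SupportedIn q (box 0 r) →
      SupportedIn (mono c₁ * p + mono c₂ * q) (box c₁ r ∪ box c₂ r) := fun hp hq =>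
    ((hp.mono_mul c₁).mono Set.subset_union_left).add
      ((hq.mono_mul c₂).mono Set.subset_union_right)
  refine ⟨s, ?_, ?_⟩
  · convert hsupp ha₁ ha₂ using 1
    linear_combination laurent_add_self (s * f) + hs
  · convert hsupp hb₁ hb₂ using 1
    linear_combination laurent_add_self (s * g) + hs'

end Splitting

/-! ### Pauli operators as pairs of Laurent polynomials -/

/-- The sum of the values of the symplectic form over all sites. -/
def pairing (O : PauliOp) : PauliOp →+ ZMod 2 :=
  Finsupp.liftAddHom fun s =>
    { toFun := fun P => symp P (O s)
      map_zero' := by simp [symp]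
      map_add' := fun P Q => by simp only [symp, Prod.fst_add, Prod.snd_add, add_dotProduct]; ring }

lemma opCommute_iff {P O : PauliOp} : OpCommute P O ↔ pairing O P = 0 := Iff.rfl

lemma pairing_single (O : PauliOp) (s : Site) (P : SitePauli) :
    pairing O (Finsupp.single s P) = symp P (O s) :=
  Finsupp.sum_single_index (h := fun s P => symp P (O s)) (by simp [symp])

lemma pairing_eq_sum (O P : PauliOp) : pairing O P = ∑ s ∈ P.support, symp (P s) (O s) := rfl

lemma pairing_add_left (O O' P : PauliOp) : pairing (O + O') P = pairing O P + pairing O' P := by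
  simp only [pairing_eq_sum, ← Finset.sum_add_distrib]
  refine Finset.sum_congr rfl fun s _ => ?_
  simp only [symp, Finsupp.add_apply, Prod.fst_add, Prod.snd_add, dotProduct_add]
  ring

/-- The Laurent polynomial of the `i`-th components of the `Z`-part. -/
def zPart (O : PauliOp) (i : Fin 2) : Laurent :=
  .ofCoeff (O.mapRange (fun P => P.2 i) rfl)

/-- The Laurent polynomial of the `i`-th components of the `X`-part, reflected in the origin. -/
def xPart (O : PauliOp) (i : Fin 2) : Laurent :=
  .ofCoeff ((O.mapRange (fun P => P.1 i) rfl).equivMapDomain (Equiv.neg Site))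

lemma coeff_zPart (O : PauliOp) (i : Fin 2) (s : Site) : (zPart O i).coeff s = (O s).2 i := by
  simp [zPart]

lemma coeff_xPart (O : PauliOp) (i : Fin 2) (s : Site) : (xPart O i).coeff s = (O (-s)).1 i := by
  simp [xPart]

/-- The `Z`-type operator with given components. -/
def zOp (p : Fin 2 → Laurent) : PauliOp :=
  Finsupp.onFinset ((p 0).coeff.support ∪ (p 1).coeff.support)
    (fun s => (0, fun i => (p i).coeff s)) (by
      intro s hs
      by_contra hn
      simp only [Finset.mem_union, Finsupp.mem_support_iff, not_or, not_not] at hn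
      refine hs (Prod.ext rfl (funext fun i => ?_))
      fin_cases i
      exacts [hn.1, hn.2])

/-- The `X`-type operator with given components, reflected in the origin. -/
def xOp (p : Fin 2 → Laurent) : PauliOp :=
  (Finsupp.onFinset ((p 0).coeff.support ∪ (p 1).coeff.support)
    (fun s => ((fun i => (p i).coeff s, 0) : SitePauli)) (by
      intro s hs
      by_contra hn
      simp only [Finset.mem_union, Finsupp.mem_support_iff, not_or, not_not] at hn
      refine hs (Prod.ext (funext fun i => ?_) rfl)
      fin_cases i
      exacts [hn.1, hn.2])).equivMapDomain (Equiv.neg Site)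

lemma zOp_apply (p : Fin 2 → Laurent) (s : Site) : zOp p s = (0, fun i => (p i).coeff s) := by
  simp [zOp]

lemma xOp_apply (p : Fin 2 → Laurent) (s : Site) : xOp p s = (fun i => (p i).coeff (-s), 0) := by
  simp [xOp]

namespace CornerTable

variable (T : CornerTable)

/-- The `i`-th component of the corner operators of the `Z`-type generator, as a polynomial. -/
def cornerPoly (i : Fin 2) : Laurent :=
  ∑ a : Fin 2, ∑ b : Fin 2, ∑ c : Fin 2,
    AddMonoidAlgebra.single ((a.val : ℤ), (b.val : ℤ), (c.val : ℤ)) (T.zCorner a b c i)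

lemma coeff_cornerPoly_mul (i : Fin 2) (e : Laurent) (s : Site) :
    (T.cornerPoly i * e).coeff s = ∑ a : Fin 2, ∑ b : Fin 2, ∑ c : Fin 2,
      T.zCorner a b c i * e.coeff (s - ((a.val : ℤ), (b.val : ℤ), (c.val : ℤ))) := by
  simp only [cornerPoly, Finset.sum_mul, AddMonoidAlgebra.coeff_sum, Finsupp.finsetSum_apply,
    AddMonoidAlgebra.coeff_single_mul_apply, neg_add_eq_sub]

lemma coeff_cornerPoly (i : Fin 2) (s : Site) :
    (T.cornerPoly i).coeff s = ∑ a : Fin 2, ∑ b : Fin 2, ∑ c : Fin 2,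
      if ((a.val : ℤ), (b.val : ℤ), (c.val : ℤ)) = s then T.zCorner a b c i else 0 := by
  simp only [cornerPoly, AddMonoidAlgebra.coeff_sum, Finsupp.finsetSum_apply,
    AddMonoidAlgebra.coeff_single, Finsupp.single_apply]

lemma val_rev (a : Fin 2) : ((a.rev.val : ℕ) : ℤ) = 1 - a.val := by
  fin_cases a <;> rfl

lemma sum_rev {M : Type*} [AddCommMonoid M] (F : Fin 2 → Fin 2 → Fin 2 → M) :
    ∑ a : Fin 2, ∑ b : Fin 2, ∑ c : Fin 2, F a.rev b.rev c.rev =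
      ∑ a : Fin 2, ∑ b : Fin 2, ∑ c : Fin 2, F a b c := by
  rw [← Equiv.sum_comp Fin.revPerm]
  refine Finset.sum_congr rfl fun a _ => ?_
  rw [← Equiv.sum_comp Fin.revPerm]
  refine Finset.sum_congr rfl fun b _ => ?_
  rw [← Equiv.sum_comp Fin.revPerm]
  simp

lemma zGen_apply (v t : Site) : T.zGen v t = (0, fun i => (T.cornerPoly i).coeff (t - v)) := by
  have h : ∀ a b c : Fin 2, ((v.1 + (a.val : ℤ), v.2.1 + (b.val : ℤ), v.2.2 + (c.val : ℤ)) = t) ↔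
      (((a.val : ℤ), (b.val : ℤ), (c.val : ℤ)) = t - v) := by
    intro a b c
    simp only [Prod.ext_iff, Prod.fst_sub, Prod.snd_sub]
    omega
  refine Prod.ext ?_ (funext fun i => ?_)
  · simp [zGen, Finsupp.single_apply, apply_ite Prod.fst]
  · simp only [zGen, Finsupp.finsetSum_apply, Finsupp.single_apply, coeff_cornerPoly, h,
      Prod.snd_sum, Finset.sum_apply]
    refine Finset.sum_congr rfl fun a _ => Finset.sum_congr rfl fun b _ =>
      Finset.sum_congr rfl fun c _ => ?_
    split_ifs <;> rfl

/-- The `X`-type generator is the `Z`-type one reflected in the centre of the cube with qubits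
exchanged, so the offset `t - v` becomes `v + (1, 1, 1) - t`. -/
lemma xGen_apply (v t : Site) :
    T.xGen v t = (fun i => (T.cornerPoly i.rev).coeff (v + (1, 1, 1) - t), 0) := by
  have h : ∀ a b c : Fin 2,
      ((v.1 + (a.val : ℤ), v.2.1 + (b.val : ℤ), v.2.2 + (c.val : ℤ)) = t) ↔
      (((a.rev.val : ℤ), (b.rev.val : ℤ), (c.rev.val : ℤ)) = v + (1, 1, 1) - t) := by
    intro a b c
    simp only [Prod.ext_iff, Prod.fst_sub, Prod.snd_sub, Prod.fst_add, Prod.snd_add, val_rev]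
    omega
  refine Prod.ext (funext fun i => ?_) ?_
  · simp only [xGen, Finsupp.finsetSum_apply, Finsupp.single_apply, coeff_cornerPoly, h,
      Prod.fst_sum, Finset.sum_apply]
    refine Eq.trans ?_ (sum_rev fun a b c => if ((a.val : ℤ), (b.val : ℤ), (c.val : ℤ)) =
      v + (1, 1, 1) - t then T.zCorner a b c i.rev else 0)
    refine Finset.sum_congr rfl fun a _ => Finset.sum_congr rfl fun b _ =>
      Finset.sum_congr rfl fun c _ => ?_
    split_ifs <;> rfl
  · simp [xGen, Finsupp.single_apply, apply_ite Prod.snd]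

/-- The syndrome with respect to the `Z`-type generators, reflected in the origin. -/
def zSyndrome (O : PauliOp) : Laurent :=
  T.cornerPoly 0 * xPart O 0 + T.cornerPoly 1 * xPart O 1

/-- The syndrome with respect to the `X`-type generators. -/
def xSyndrome (O : PauliOp) : Laurent :=
  T.cornerPoly 1 * zPart O 0 + T.cornerPoly 0 * zPart O 1

lemma pairing_zGen (O : PauliOp) (v : Site) :
    pairing O (T.zGen v) = (T.zSyndrome O).coeff (-v) := by
  simp only [zGen, map_sum, pairing_single, zSyndrome, AddMonoidAlgebra.coeff_add,
    Finsupp.add_apply, coeff_cornerPoly_mul, coeff_xPart, ← Finset.sum_add_distrib]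
  refine Finset.sum_congr rfl fun a _ => Finset.sum_congr rfl fun b _ =>
      Finset.sum_congr rfl fun c _ => ?_
  have : -(-v - ((a.val : ℤ), (b.val : ℤ), (c.val : ℤ))) =
      (v.1 + (a.val : ℤ), v.2.1 + (b.val : ℤ), v.2.2 + (c.val : ℤ)) := by
    ext <;> simp [add_comm]
  rw [this]
  simp [symp, dotProduct, Fin.sum_univ_two]

lemma pairing_xGen (O : PauliOp) (v : Site) :
    pairing O (T.xGen v) = (T.xSyndrome O).coeff (v + (1, 1, 1)) := by
  simp only [xGen, map_sum, pairing_single, xSyndrome, AddMonoidAlgebra.coeff_add,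
    Finsupp.add_apply, coeff_cornerPoly_mul, coeff_zPart, ← Finset.sum_add_distrib]
  rw [← sum_rev fun a b c => T.zCorner a b c 1 * _ + _]
  refine Finset.sum_congr rfl fun a _ => Finset.sum_congr rfl fun b _ =>
      Finset.sum_congr rfl fun c _ => ?_
  have : v + (1, 1, 1) - ((a.rev.val : ℤ), (b.rev.val : ℤ), (c.rev.val : ℤ)) =
      (v.1 + (a.val : ℤ), v.2.1 + (b.val : ℤ), v.2.2 + (c.val : ℤ)) := by
    simp only [val_rev]
    ext <;> simp <;> ring
  rw [this]
  simp [symp, dotProduct, Fin.sum_univ_two, xCorner]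

lemma zOp_mem_stabilizerGroup (s : Laurent) :
    zOp (fun i => s * T.cornerPoly i) ∈ stabilizerGroup T.generators := by
  induction s using laurent_induction with
  | zero =>
    convert AddSubgroup.zero_mem _ using 1
    ext t : 1
    simp [zOp_apply]
    rfl
  | add e₁ e₂ h₁ h₂ =>
    convert AddSubgroup.add_mem _ h₁ h₂ using 1
    ext t : 1
    simp only [zOp_apply, Finsupp.add_apply, add_mul, AddMonoidAlgebra.coeff_add]
    refine Prod.ext ?_ ?_
    · simp
    · rfl
  | mono n =>
    refine AddSubgroup.subset_closure (Or.inl ⟨n, ?_⟩)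
    ext t : 1
    simp only [zOp_apply, zGen_apply, coeff_mono_mul]

lemma xOp_mem_stabilizerGroup (s : Laurent) :
    xOp (fun i => s * T.cornerPoly i.rev) ∈ stabilizerGroup T.generators := by
  induction s using laurent_induction with
  | zero =>
    convert AddSubgroup.zero_mem _ using 1
    ext t : 1
    simp [xOp_apply]
    rfl
  | add e₁ e₂ h₁ h₂ =>
    convert AddSubgroup.add_mem _ h₁ h₂ using 1
    ext t : 1
    simp only [xOp_apply, Finsupp.add_apply, add_mul, AddMonoidAlgebra.coeff_add]
    refine Prod.ext ?_ ?_
    · rfl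
    · simp
  | mono n =>
    refine AddSubgroup.subset_closure (Or.inr ⟨-n - (1, 1, 1), ?_⟩)
    ext t : 1
    have : -n - (1, 1, 1) + (1, 1, 1) - t = -t - n := by abel
    simp only [xOp_apply, xGen_apply, coeff_mono_mul, this]

/-- Generators of one type commute trivially. Between the types the syndrome is a monomial times `fg
+ gf`, which is zero in characteristic two. -/
lemma pairing_generator_generator {P Q : PauliOp} (hP : P ∈ T.generators)
    (hQ : Q ∈ T.generators) : pairing Q P = 0 := by
  have hz : ∀ v i, zPart (T.zGen v) i = mono v * T.cornerPoly i := fun v i => by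
    ext s; rw [coeff_zPart, zGen_apply, coeff_mono_mul]
  have hz' : ∀ v i, xPart (T.zGen v) i = 0 := fun v i => by
    ext s; rw [coeff_xPart, zGen_apply]; rfl
  have hx : ∀ v i, xPart (T.xGen v) i = mono (-(v + (1, 1, 1))) * T.cornerPoly i.rev :=
    fun v i => by
      ext s
      rw [coeff_xPart, xGen_apply, coeff_mono_mul, sub_neg_eq_add, sub_neg_eq_add, add_comm]
  have hx' : ∀ v i, zPart (T.xGen v) i = 0 := fun v i => by
    ext s; rw [coeff_zPart, xGen_apply]; rfl
  rcases hP with ⟨v, rfl⟩ | ⟨v, rfl⟩ <;> rcases hQ with ⟨u, rfl⟩ | ⟨u, rfl⟩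
  · simp [pairing_zGen, zSyndrome, hz']
  · have : T.zSyndrome (T.xGen u) = 0 := by
      rw [zSyndrome, hx, hx, show (0 : Fin 2).rev = 1 from rfl, show (1 : Fin 2).rev = 0 from rfl]
      convert laurent_add_self (mono (-(u + (1, 1, 1))) * (T.cornerPoly 0 * T.cornerPoly 1)) using 1
      ring
    rw [pairing_zGen, this]; rfl
  · have : T.xSyndrome (T.zGen u) = 0 := by
      rw [xSyndrome, hz, hz]
      convert laurent_add_self (mono u * (T.cornerPoly 0 * T.cornerPoly 1)) using 1
      ring
    rw [pairing_xGen, this]; rfl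
  · simp [pairing_xGen, xSyndrome, hx']

lemma pairing_generator_stabilizer {P S : PauliOp} (hP : P ∈ T.generators)
    (hS : S ∈ stabilizerGroup T.generators) : pairing S P = 0 := by
  induction hS using AddSubgroup.closure_induction with
  | mem Q hQ => exact T.pairing_generator_generator hP hQ
  | zero => simp [pairing_eq_sum, symp]
  | add Q Q' _ _ h h' => rw [pairing_add_left, h, h', add_zero]
  | neg Q _ h =>
    have := pairing_add_left Q (-Q) P
    rw [add_neg_cancel, h, zero_add] at this
    rw [← this]
    simp [pairing_eq_sum, symp]

lemma mem_unitCube_of_coeff_cornerPoly_ne_zero {i : Fin 2} {s : Site}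
    (h : (T.cornerPoly i).coeff s ≠ 0) :
    (0 ≤ s.1 ∧ s.1 ≤ 1) ∧ (0 ≤ s.2.1 ∧ s.2.1 ≤ 1) ∧ (0 ≤ s.2.2 ∧ s.2.2 ≤ 1) := by
  rw [coeff_cornerPoly] at h
  obtain ⟨a, -, h⟩ := Finset.exists_ne_zero_of_sum_ne_zero h
  obtain ⟨b, -, h⟩ := Finset.exists_ne_zero_of_sum_ne_zero h
  obtain ⟨c, -, h⟩ := Finset.exists_ne_zero_of_sum_ne_zero h
  have := (ite_ne_right_iff.1 h).1
  subst this
  simp only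
  omega

lemma sub_mem_unitCube_of_generator {P : PauliOp} {v t : Site}
    (hP : P = T.zGen v ∨ P = T.xGen v) (ht : P t ≠ 0) :
    (v.1 ≤ t.1 ∧ t.1 ≤ v.1 + 1) ∧ (v.2.1 ≤ t.2.1 ∧ t.2.1 ≤ v.2.1 + 1) ∧
      (v.2.2 ≤ t.2.2 ∧ t.2.2 ≤ v.2.2 + 1) := by
  rcases hP with rfl | rfl
  · rw [zGen_apply] at ht
    obtain ⟨i, hi⟩ : ∃ i, (T.cornerPoly i).coeff (t - v) ≠ 0 := by
      by_contra! hn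
      exact ht (Prod.ext rfl (funext hn))
    have := T.mem_unitCube_of_coeff_cornerPoly_ne_zero hi
    simp only [Prod.fst_sub, Prod.snd_sub] at this
    omega
  · rw [xGen_apply] at ht
    obtain ⟨i, hi⟩ : ∃ i : Fin 2, (T.cornerPoly i.rev).coeff (v + (1, 1, 1) - t) ≠ 0 := by
      by_contra! hn
      exact ht (Prod.ext (funext hn) rfl)
    have := T.mem_unitCube_of_coeff_cornerPoly_ne_zero hi
    simp only [Prod.fst_sub, Prod.snd_sub, Prod.fst_add, Prod.snd_add] at this
    omega

lemma Linked.abs_le {s t : Site} (h : Linked T.generators s t) :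
    |t.1 - s.1| ≤ 1 ∧ |t.2.1 - s.2.1| ≤ 1 ∧ |t.2.2 - s.2.2| ≤ 1 := by
  obtain ⟨P, hP, hs, ht⟩ := h
  obtain ⟨v, hv⟩ : ∃ v, P = T.zGen v ∨ P = T.xGen v := by
    rcases hP with ⟨v, rfl⟩ | ⟨v, rfl⟩
    exacts [⟨v, Or.inl rfl⟩, ⟨v, Or.inr rfl⟩]
  have h₁ := T.sub_mem_unitCube_of_generator hv hs
  have h₂ := T.sub_mem_unitCube_of_generator hv ht
  simp only [_root_.abs_le]
  omega

/-! ### String segments -/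

section Segments

variable {T} {ζ : Segment}

lemma exists_of_not_opCommute (hζ : IsLogicalStringSegment T.generators ζ) {P : PauliOp}
    (hP : P ∈ T.generators) (hne : pairing ζ.op P ≠ 0) :
    (∃ t ∈ cube ζ.corner₁ ζ.width, P t ≠ 0) ∨ ∃ t ∈ cube ζ.corner₂ ζ.width, P t ≠ 0 := by
  by_contra! hn
  exact hne (hζ P hP hn.1 hn.2)

lemma supportedIn_xSyndrome (hζ : IsLogicalStringSegment T.generators ζ) :
    SupportedIn (T.xSyndrome ζ.op)
      (box ζ.corner₁ (ζ.width + 1) ∪ box ζ.corner₂ (ζ.width + 1)) := by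
  intro s hs
  have hne : pairing ζ.op (T.xGen (s - (1, 1, 1))) ≠ 0 := by
    rwa [pairing_xGen, sub_add_cancel]
  refine (exists_of_not_opCommute hζ (Or.inr ⟨_, rfl⟩) hne).imp ?_ ?_ <;>
  · rintro ⟨t, ⟨h₁, h₂, h₃⟩, ht⟩
    have := T.sub_mem_unitCube_of_generator (Or.inr rfl) ht
    simp only [Prod.fst_sub, Prod.snd_sub] at this
    simp only [box, Set.mem_ofPred_eq, _root_.abs_le]
    omega

lemma supportedIn_zSyndrome (hζ : IsLogicalStringSegment T.generators ζ) :
    SupportedIn (T.zSyndrome ζ.op)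
      (box (-ζ.corner₁) (ζ.width + 1) ∪ box (-ζ.corner₂) (ζ.width + 1)) := by
  intro s hs
  have hne : pairing ζ.op (T.zGen (-s)) ≠ 0 := by
    rwa [pairing_zGen, neg_neg]
  refine (exists_of_not_opCommute hζ (Or.inl ⟨_, rfl⟩) hne).imp ?_ ?_ <;>
  · rintro ⟨t, ⟨h₁, h₂, h₃⟩, ht⟩
    have := T.sub_mem_unitCube_of_generator (Or.inl rfl) ht
    simp only [Prod.fst_neg, Prod.snd_neg] at this
    simp only [box, Set.mem_ofPred_eq, _root_.abs_le, Prod.fst_neg, Prod.snd_neg]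
    omega

lemma cube_subset_box (p : Site) (w : ℕ) : cube p w ⊆ box p w := by
  rintro s ⟨h₁, h₂, h₃⟩
  simp only [box, Set.mem_ofPred_eq, _root_.abs_le]
  omega

/-- Sites of the two boxes at sup-distance at most one would bound each coordinate of the
displacement by `2 * r + 1`. Beyond three times that, a path cannot leave the first box. -/
lemma not_isConnected {r : ℕ} (hw : ζ.width ≤ r)
    (hsupp : (ζ.op.support : Set Site) ⊆ box ζ.corner₁ r ∪ box ζ.corner₂ r)
    (hl : 3 * (2 * r + 1) < ζ.length) : ¬ IsConnected T.generators ζ := by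
  rintro ⟨p, hp, q, hq, -, hpath⟩
  have hp' := box_mono _ hw (cube_subset_box _ _ hp)
  have hq' := box_mono _ hw (cube_subset_box _ _ hq)
  have hfar : ∀ s t : Site, s ∈ box ζ.corner₁ r → t ∈ box ζ.corner₂ r →
      ¬ (|t.1 - s.1| ≤ 1 ∧ |t.2.1 - s.2.1| ≤ 1 ∧ |t.2.2 - s.2.2| ≤ 1) := by
    intro s t hs ht hst
    simp only [box, Set.mem_ofPred_eq, _root_.abs_le] at hs ht hst
    simp only [Segment.length] at hl
    omega
  have hM : ((ζ.op.support : Set Site) ∪ {p, q}) ⊆ box ζ.corner₁ r ∪ box ζ.corner₂ r := by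
    refine Set.union_subset hsupp ?_
    rintro s (rfl | rfl)
    exacts [Or.inl hp', Or.inr hq']
  have hmem : ∀ t, Relation.ReflTransGen (fun s t => t ∈ ((ζ.op.support : Set Site) ∪ {p, q}) ∧
      Linked T.generators s t) p t → t ∈ box ζ.corner₁ r := by
    intro t ht
    induction ht with
    | refl => exact hp'
    | tail _ hst ih =>
      exact (hM hst.1).resolve_right fun h => hfar _ _ ih h (Linked.abs_le T hst.2)
  exact hfar q q (hmem q hpath) hq' (by simp)

lemma mem_of_op_apply_ne_zero {O : PauliOp} {S : Set Site}
    (hz : ∀ i, SupportedIn (zPart O i) S) (hx : ∀ i, SupportedIn (xPart O i) (-S)) :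
    (O.support : Set Site) ⊆ S := by
  intro s hs
  by_contra hn
  refine (Finsupp.mem_support_iff.1 hs) (Prod.ext (funext fun i => ?_) (funext fun i => ?_))
  · have := not_imp_comm.1 (hx i (-s)) (by simpa using hn)
    rwa [coeff_xPart, neg_neg] at this
  · have := not_imp_comm.1 (hz i s) hn
    rwa [coeff_zPart] at this

lemma neg_box (c : Site) (r : ℕ) : -box c r = box (-c) r := by
  ext s
  simp only [box, Set.mem_neg, Set.mem_ofPred_eq, _root_.abs_le, Prod.fst_neg, Prod.snd_neg]
  omega

theorem freeOfStrings_of_isRigid (h : IsRigid (T.cornerPoly 0) (T.cornerPoly 1)) :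
    FreeOfStrings T.generators := by
  intro w _
  obtain ⟨N, r, hN⟩ := h.exists_supportedIn (w + 1)
  refine lt_of_le_of_lt (b := ((max N (3 * (2 * max r w + 1)) : ℕ) : ℕ∞)) ?_ (ENat.natCast_lt_top _)
  refine iSup₂_le fun ζ hζ => ?_
  obtain ⟨rfl, hlog, hnt⟩ := hζ
  by_contra hlt
  simp only [not_le, Nat.cast_lt, max_lt_iff] at hlt
  obtain ⟨hlN, hlr⟩ := hlt
  obtain ⟨s, hs₀, hs₁⟩ := hN ζ.corner₁ ζ.corner₂ (zPart ζ.op 0) (zPart ζ.op 1)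
    (by simp only [l1, Segment.length, Prod.fst_sub, Prod.snd_sub] at hlN ⊢; omega)
    (supportedIn_xSyndrome hlog)
  -- The `Z`-syndrome pairs `f` with component 0 and `g` with component 1, so the components enter
  -- in reverse order; reflection negates the centres.
  obtain ⟨u, hu₁, hu₀⟩ := hN (-ζ.corner₁) (-ζ.corner₂) (xPart ζ.op 1) (xPart ζ.op 0)
    (by simp only [l1, Segment.length, Prod.fst_sub, Prod.snd_sub, Prod.fst_neg, Prod.snd_neg]
          at hlN ⊢
        omega)
    (by have := supportedIn_zSyndrome hlog
        rwa [zSyndrome, add_comm] at this)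
  set S := zOp (fun i => s * T.cornerPoly i) + xOp (fun i => u * T.cornerPoly i.rev)
  have hS : S ∈ stabilizerGroup T.generators :=
    AddSubgroup.add_mem _ (T.zOp_mem_stabilizerGroup s) (T.xOp_mem_stabilizerGroup u)
  have hzS : ∀ i, zPart (ζ.op + S) i = zPart ζ.op i + s * T.cornerPoly i := fun i => by
    ext t
    simp [S, coeff_zPart, zOp_apply, xOp_apply]
  have hxS : ∀ i, xPart (ζ.op + S) i = xPart ζ.op i + u * T.cornerPoly i.rev := fun i => by
    ext t
    simp [S, coeff_xPart, zOp_apply, xOp_apply]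
  refine not_isConnected (T := T) (ζ := ⟨ζ.op + S, ζ.corner₁, ζ.corner₂, ζ.width⟩)
    (r := max r ζ.width) (le_max_right _ _) ?_ hlr (hnt _ ?_ ⟨rfl, rfl, rfl, S, hS, rfl⟩)
  · refine Set.Subset.trans (mem_of_op_apply_ne_zero (S := box ζ.corner₁ r ∪ box ζ.corner₂ r)
      ?_ ?_) (Set.union_subset_union (box_mono _ (le_max_left _ _)) (box_mono _ (le_max_left _ _)))
    · intro i
      rw [hzS]
      fin_cases i
      exacts [hs₀, hs₁]
    · intro i
      rw [hxS, Set.union_neg, neg_box, neg_box]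
      fin_cases i
      exacts [hu₀, hu₁]
  · intro P hP h₁ h₂
    rw [opCommute_iff, pairing_add_left, T.pairing_generator_stabilizer hP hS, add_zero]
    exact hlog P hP h₁ h₂

end Segments

end CornerTable

/-! ### Irreducible quadratics -/

section Quadratic

open Polynomial

/-- A constant factor divides all coefficients and is a unit by `hprim`; the only other splitting is
into two linear factors, excluded by `hfac`. -/
lemma irreducible_quadratic {R : Type*} [CommRing R] [IsDomain R] {a b c : R} (ha : a ≠ 0)
    (hprim : ∀ d, d ∣ a → d ∣ b → d ∣ c → IsUnit d)
    (hfac : ∀ p q r s, p * r = a → p * s + q * r = b → q * s = c → False) :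
    Irreducible (C a * X ^ 2 + C b * X + C c) := by
  have hdeg : (C a * X ^ 2 + C b * X + C c).natDegree = 2 := natDegree_quadratic ha
  have hconst : ∀ f g : R[X], C a * X ^ 2 + C b * X + C c = f * g → f.natDegree = 0 →
      IsUnit f := by
    intro f g hfg hf
    rw [eq_C_of_natDegree_eq_zero hf] at hfg ⊢
    have hdvd : ∀ n, f.coeff 0 ∣ (C a * X ^ 2 + C b * X + C c).coeff n := fun n => by
      rw [hfg, coeff_C_mul]; exact dvd_mul_right _ _
    refine (hprim _ ?_ ?_ ?_).map C
    · simpa [coeff_X, coeff_C] using hdvd 2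
    · simpa [coeff_X, coeff_C] using hdvd 1
    · simpa using hdvd 0
  have hne : C a * X ^ 2 + C b * X + C c ≠ 0 := by
    intro h0
    rw [h0, natDegree_zero] at hdeg
    exact absurd hdeg (by norm_num)
  refine ⟨fun h => ?_, fun f g hfg => ?_⟩
  · rw [natDegree_eq_zero_of_isUnit h] at hdeg
    exact absurd hdeg (by norm_num)
  · have hfg0 := hne
    rw [hfg, mul_ne_zero_iff] at hfg0
    have hsum : f.natDegree + g.natDegree = 2 := by
      rw [← natDegree_mul hfg0.1 hfg0.2, ← hfg, hdeg]
    by_cases hf : f.natDegree = 0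
    · exact Or.inl (hconst f g hfg hf)
    by_cases hg : g.natDegree = 0
    · exact Or.inr (hconst g f (by rw [hfg, mul_comm]) hg)
    exfalso
    obtain ⟨p, q, rfl⟩ := exists_eq_X_add_C_of_natDegree_le_one (show f.natDegree ≤ 1 by omega)
    obtain ⟨r, s, rfl⟩ := exists_eq_X_add_C_of_natDegree_le_one (show g.natDegree ≤ 1 by omega)
    have hexp : (C p * X + C q) * (C r * X + C s) =
        C (p * r) * X ^ 2 + C (p * s + q * r) * X + C (q * s) := by
      simp only [map_mul, map_add]; ring
    rw [hexp] at hfg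
    have hcoeff := fun n => congrArg (fun F : R[X] => F.coeff n) hfg
    have hquad : ∀ a b c : R, (C a * X ^ 2 + C b * X + C c).coeff 2 = a ∧
        (C a * X ^ 2 + C b * X + C c).coeff 1 = b ∧
        (C a * X ^ 2 + C b * X + C c).coeff 0 = c := fun a b c => by
      refine ⟨?_, ?_, ?_⟩ <;> simp [coeff_X, coeff_C]
    have h2 := hcoeff 2
    have h1 := hcoeff 1
    have h0 := hcoeff 0
    simp only [hquad] at h2 h1 h0
    exact hfac p q r s h2.symm h1.symm h0.symm

lemma two_eq_zero_poly : (2 : (ZMod 2)[X]) = 0 := CharTwo.two_eq_zero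

/-- For linear factors `px + q` and `rx + s`, the values at y = 0 force q and s to vanish there. The
coefficient of y in the middle term then gives q₁ + s₁ = 1, and that of y² in the last gives q₁s₁ =
1, which is impossible over two elements. -/
lemma code1_resultant_prime : Prime (C (1 + X - X ^ 2 : (ZMod 2)[X]) * X ^ 2 + C (X + X ^ 2) * X
    + C (X ^ 2)) := by
  refine (irreducible_quadratic ?_ ?_ ?_).prime
  · intro h
    simpa using congrArg (fun F : (ZMod 2)[X] => F.coeff 0) h
  · intro d h₁ h₂ h₃
    refine isUnit_of_dvd_one ?_
    convert ((h₁.add h₃).sub (h₂.sub h₃) : _ ∣ _) using 1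
    ring
  · intro p q r s h₁ h₂ h₃
    have c₁ := congrArg (fun F : (ZMod 2)[X] => F.coeff 0) h₁
    have c₂ := congrArg (fun F : (ZMod 2)[X] => F.coeff 0) h₂
    have c₃ := congrArg (fun F : (ZMod 2)[X] => F.coeff 0) h₃
    have d₂ := congrArg (fun F : (ZMod 2)[X] => F.coeff 1) h₂
    have d₃ := congrArg (fun F : (ZMod 2)[X] => F.coeff 2) h₃
    simp [coeff_mul, coeff_X, coeff_one,
      Finset.Nat.antidiagonal_succ] at c₁ c₂ c₃ d₂ d₃
    generalize p.coeff 0 = p₀, p.coeff 1 = p₁, q.coeff 0 = q₀, q.coeff 1 = q₁, q.coeff 2 = q₂,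
      r.coeff 0 = r₀, r.coeff 1 = r₁, s.coeff 0 = s₀, s.coeff 1 = s₁, s.coeff 2 = s₂ at *
    clear h₁ h₂ h₃
    obtain ⟨rfl, rfl⟩ := c₁
    have h0 : q₀ = 0 ∧ s₀ = 0 := by
      clear d₂ d₃
      revert q₀ s₀
      decide
    obtain ⟨rfl, rfl⟩ := h0
    simp only [zero_mul, mul_zero, add_zero, zero_add, one_mul, mul_one] at d₂ d₃
    clear c₂ c₃
    revert q₁ s₁
    decide

/-- At y = 0 the quadratic becomes x² + x + 1, which is irreducible over two elements. It is
primitive because its middle coefficient is 1 in characteristic two. -/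
lemma code2_resultant_prime : Prime (C (1 + 2 * X + X ^ 2 : (ZMod 2)[X]) * X ^ 2
    + C ((1 + X) * (1 + 2 * X) - X) * X + C (X + X ^ 2 - 1)) := by
  refine (irreducible_quadratic ?_ ?_ ?_).prime
  · intro h
    simpa using congrArg (fun F : (ZMod 2)[X] => F.coeff 0) h
  · intro d h₁ h₂ h₃
    refine isUnit_of_dvd_one (h₂.trans (dvd_of_eq ?_))
    linear_combination (X + X ^ 2) * two_eq_zero_poly
  · intro p q r s h₁ h₂ h₃
    have c₁ := congrArg (fun F : (ZMod 2)[X] => F.coeff 0) h₁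
    have c₂ := congrArg (fun F : (ZMod 2)[X] => F.coeff 0) h₂
    have c₃ := congrArg (fun F : (ZMod 2)[X] => F.coeff 0) h₃
    simp [mul_coeff_zero] at c₁ c₂ c₃
    generalize p.coeff 0 = p₀, q.coeff 0 = q₀, r.coeff 0 = r₀, s.coeff 0 = s₀ at *
    clear h₁ h₂ h₃
    revert p₀ q₀ r₀ s₀
    decide

/-- Eisenstein's criterion at y: the coefficients are (1 + y)², y and -y. -/
lemma code4_resultant_prime : Prime (C (1 + 2 * X + X ^ 2 : (ZMod 2)[X]) * X ^ 2
    + C (X * (1 + X) - X ^ 2) * X + C (-X)) := by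
  refine (irreducible_quadratic ?_ ?_ ?_).prime
  · intro h
    simpa using congrArg (fun F : (ZMod 2)[X] => F.coeff 0) h
  · intro d h₁ h₂ h₃
    refine isUnit_of_dvd_one ?_
    convert (h₁.add (h₃.mul_left (2 + X)) : _ ∣ _) using 1
    ring
  · intro p q r s h₁ h₂ h₃
    have c₁ := congrArg (fun F : (ZMod 2)[X] => F.coeff 0) h₁
    have c₂ := congrArg (fun F : (ZMod 2)[X] => F.coeff 0) h₂
    have c₃ := congrArg (fun F : (ZMod 2)[X] => F.coeff 0) h₃
    have d₃ := congrArg (fun F : (ZMod 2)[X] => F.coeff 1) h₃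
    simp [mul_coeff_zero, mul_coeff_one] at c₁ c₂ c₃ d₃
    generalize p.coeff 0 = p₀, q.coeff 0 = q₀, q.coeff 1 = q₁,
      r.coeff 0 = r₀, s.coeff 0 = s₀, s.coeff 1 = s₁ at *
    clear h₁ h₂ h₃
    revert p₀ q₀ q₁ r₀ s₀ s₁
    decide

/-- All three coefficients have degree 2 in y. In a factorization `(px + q)(rx + s)` the degrees of
ps and qr add up to 4. If they differ, the middle coefficient has degree above 2; if both are 2,
their leading terms cancel and its y² term is lost. -/
lemma code3_resultant_prime : Prime (C (X - (1 + X) ^ 2 : (ZMod 2)[X]) * X ^ 2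
    + C (X ^ 2 - (1 + X) * (1 + 2 * X)) * X + C (-X * (1 + X))) := by
  have ha : (X - (1 + X) ^ 2 : (ZMod 2)[X]) = C 1 * X ^ 2 + C 1 * X + C 1 := by
    simp only [map_one]
    linear_combination (-X - X ^ 2 - 1) * two_eq_zero_poly
  have hb : (X ^ 2 - (1 + X) * (1 + 2 * X) : (ZMod 2)[X]) = C 1 * X ^ 2 + C 1 * X + C 1 := by
    simp only [map_one]
    linear_combination (-2 * X - X ^ 2 - 1) * two_eq_zero_poly
  have hc : (-X * (1 + X) : (ZMod 2)[X]) = C 1 * X ^ 2 + C 1 * X + C 0 := by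
    simp only [map_one, map_zero]
    linear_combination (-X - X ^ 2) * two_eq_zero_poly
  rw [ha, hb, hc]
  have hne : ∀ e : ZMod 2, (C 1 * X ^ 2 + C 1 * X + C e : (ZMod 2)[X]) ≠ 0 := fun e h => by
    have := natDegree_quadratic (a := (1 : ZMod 2)) (b := 1) (c := e) one_ne_zero
    rw [h] at this
    simp at this
  refine (irreducible_quadratic (hne 1) ?_ ?_).prime
  · intro d h₁ h₂ h₃
    refine isUnit_of_dvd_one ?_
    convert (h₁.sub h₃ : _ ∣ _) using 1
    simp
  · intro p q r s h₁ h₂ h₃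
    have hpr := h₁ ▸ hne 1
    have hqs := h₃ ▸ hne 0
    rw [mul_ne_zero_iff] at hpr hqs
    have e₁ : p.natDegree + r.natDegree = 2 := by
      rw [← natDegree_mul hpr.1 hpr.2, h₁, natDegree_quadratic one_ne_zero]
    have e₂ : q.natDegree + s.natDegree = 2 := by
      rw [← natDegree_mul hqs.1 hqs.2, h₃, natDegree_quadratic one_ne_zero]
    have hlc : ∀ F : (ZMod 2)[X], F ≠ 0 → F.leadingCoeff = 1 := fun F hF => by
      have : ∀ t : ZMod 2, t ≠ 0 → t = 1 := by decide
      exact this _ (leadingCoeff_ne_zero.2 hF)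
    have l₁ := coeff_mul_degree_add_degree p s
    have l₂ := coeff_mul_degree_add_degree q r
    rw [hlc _ hpr.1, hlc _ hqs.2, mul_one] at l₁
    rw [hlc _ hqs.1, hlc _ hpr.2, mul_one] at l₂
    have hbig : ∀ n, 2 < n → (p * s + q * r).coeff n = 0 := fun n hn => by
      rw [h₂]
      exact coeff_eq_zero_of_natDegree_lt (by rwa [natDegree_quadratic one_ne_zero])
    rcases lt_trichotomy p.natDegree q.natDegree with h | h | h
    · have := hbig (q.natDegree + r.natDegree) (by omega)
      rw [coeff_add, l₂, coeff_eq_zero_of_natDegree_lt (natDegree_mul_le.trans_lt (by omega))]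
        at this
      simp at this
    · have := congrArg (fun F : (ZMod 2)[X] => F.coeff 2) h₂
      simp only [coeff_add] at this
      rw [show p.natDegree + s.natDegree = 2 by omega] at l₁
      rw [show q.natDegree + r.natDegree = 2 by omega] at l₂
      rw [l₁, l₂] at this
      simp [coeff_X, coeff_one] at this
    · have := hbig (p.natDegree + s.natDegree) (by omega)
      rw [coeff_add, l₁, coeff_eq_zero_of_natDegree_lt (natDegree_mul_le.trans_lt (by omega))]
        at this
      simp at this

end Quadratic

/-! ### Points over the dual numbers -/

lemma algebraMap_two_eq_zero (T : Type*) [CommRing T] [Algebra (ZMod 2) T] : (2 : T) = 0 := by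
  have := congrArg (algebraMap (ZMod 2) T) (CharTwo.two_eq_zero (R := ZMod 2))
  rwa [map_ofNat, map_zero] at this

section Points

variable {T : Type*} [CommRing T] [Algebra (ZMod 2) T]

lemma evalUnits_incl (x y z : Tˣ) (p : BivPoly) :
    evalUnits x y z (incl p) = evalBiv (x : T) y p := by
  refine congrArg (fun F : BivPoly →+* T => F p)
    (bivPoly_hom_ext (φ := ((evalUnits x y z : Laurent →+* T).comp incl)) ?_ ?_)
  · simp [incl_X, evalBiv_X, evalUnits_mono]
  · simp [incl_Y, evalBiv_Y, evalUnits_mono]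

lemma zpow_eq_one_or_self {G : Type*} [Group G] {A : G} (hA : A * A = 1) (n : ℤ) :
    (2 ∣ n ∧ A ^ n = 1) ∨ (¬ 2 ∣ n ∧ A ^ n = A) := by
  rcases Int.even_or_odd' n with ⟨m, rfl | rfl⟩
  · exact Or.inl ⟨⟨m, rfl⟩, by rw [zpow_mul, zpow_ofNat, pow_two, hA, one_zpow]⟩
  · exact Or.inr ⟨by omega, by rw [zpow_add, zpow_mul, zpow_ofNat, pow_two, hA, one_zpow, one_mul,
      zpow_one]⟩

/-- Three involutions whose seven nonempty products are nontrivial have no nontrivial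
multiplicative relation modulo squares. -/
lemma two_dvd_of_zpow_eq_one {G : Type*} [CommGroup G] {A B C : G} (hA : A * A = 1)
    (hB : B * B = 1) (hC : C * C = 1) (h₁ : A ≠ 1) (h₂ : B ≠ 1) (h₃ : C ≠ 1) (h₁₂ : A * B ≠ 1)
    (h₁₃ : A * C ≠ 1) (h₂₃ : B * C ≠ 1) (h₁₂₃ : A * B * C ≠ 1) {a b c : ℤ}
    (h : A ^ a * B ^ b * C ^ c = 1) : 2 ∣ a ∧ 2 ∣ b ∧ 2 ∣ c := by
  rcases zpow_eq_one_or_self hA a with ⟨ha, ha'⟩ | ⟨ha, ha'⟩ <;>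
  rcases zpow_eq_one_or_self hB b with ⟨hb, hb'⟩ | ⟨hb, hb'⟩ <;>
  rcases zpow_eq_one_or_self hC c with ⟨hc, hc'⟩ | ⟨hc, hc'⟩ <;>
  simp_all

/-- The data of a point over an extension of the field with two elements, together with a tangent
vector at this point: the coordinates are `w ^ i * (1 + a * ε)` and so on. No nonempty sum of the
components `a`, `b`, `c` vanishes, as these sums are powers of `w`. -/
lemma two_dvd_of_point {w ε a b c : T} {N : ℕ} (hw : w ^ (2 * N + 1) = 1) (hε : ε * ε = 0)
    (hε0 : ε ≠ 0) (i j k : ℕ)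
    (ha : ∃ m, a = w ^ m) (hb : ∃ m, b = w ^ m) (hc : ∃ m, c = w ^ m) (hab : ∃ m, a + b = w ^ m)
    (hac : ∃ m, a + c = w ^ m) (hbc : ∃ m, b + c = w ^ m) (habc : ∃ m, a + b + c = w ^ m)
    {f g : Laurent}
    (hfg : ∀ x y z : Tˣ, (x : T) = w ^ i * (1 + a * ε) → (y : T) = w ^ j * (1 + b * ε) →
      (z : T) = w ^ k * (1 + c * ε) → evalUnits x y z f = 0 ∧ evalUnits x y z g = 0)
    (n : Site) (hn : mono n - 1 ∈ Ideal.span {f, g}) : 2 ∣ n.1 ∧ 2 ∣ n.2.1 ∧ 2 ∣ n.2.2 := by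
  have h2 := algebraMap_two_eq_zero T
  have hinv : ∀ a : T, (1 + a * ε) * (1 + a * ε) = 1 := fun a => by
    linear_combination a * ε * h2 + a ^ 2 * hε
  have hne : ∀ s : T, (∃ m, s = w ^ m) → 1 + s * ε ≠ 1 := by
    rintro _ ⟨m, rfl⟩ h
    have hu : IsUnit (w ^ m) :=
      (IsUnit.of_mul_eq_one (w ^ (2 * N)) (by rw [← pow_succ', hw])).pow m
    exact hε0 (hu.mul_right_eq_zero.1 (by linear_combination h))
  set W : Tˣ := ⟨w, w ^ (2 * N), by rw [← pow_succ', hw], by rw [← pow_succ, hw]⟩ with hWdef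
  have hW : W ^ (2 * N + 1) = 1 := Units.ext (by simpa [hWdef] using hw)
  set E : T → Tˣ := fun a => ⟨1 + a * ε, 1 + a * ε, hinv a, hinv a⟩ with hE
  have hEval : ∀ a, ((E a : Tˣ) : T) = 1 + a * ε := fun a => rfl
  have hEE : ∀ a, E a * E a = 1 := fun a => Units.ext (hinv a)
  have hmul : ∀ a b, E a * E b = E (a + b) := fun a b => Units.ext (by
    rw [Units.val_mul, hEval, hEval, hEval]
    linear_combination a * b * hε)
  have hE1 : ∀ s : T, (∃ m, s = w ^ m) → E s ≠ 1 := fun s hs h =>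
    hne s hs (congrArg Units.val h)
  obtain ⟨hf, hg⟩ := hfg (W ^ i * E a) (W ^ j * E b) (W ^ k * E c)
    (by simp [hEval, hWdef]) (by simp [hEval, hWdef]) (by simp [hEval, hWdef])
  have hle : Ideal.span {f, g} ≤
      RingHom.ker (evalUnits (W ^ i * E a) (W ^ j * E b) (W ^ k * E c)) := by
    rw [Ideal.span_le]
    rintro e (rfl | rfl)
    exacts [hf, hg]
  have h1 := hle hn
  rw [RingHom.mem_ker, map_sub, map_one, evalUnits_mono, sub_eq_zero, Units.val_eq_one] at h1
  -- The odd power `2 * N + 1` kills the powers of `w` and fixes the involutions `1 + a * ε`, so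
  -- only the tangent part of the relation survives.
  have hpow : ∀ (l : ℕ) (a : T) (m : ℤ), ((W ^ l * E a) ^ m) ^ (2 * N + 1) = E a ^ m := by
    intro l a m
    rw [← zpow_natCast, zpow_comm, zpow_natCast, mul_pow, ← pow_mul, mul_comm l, pow_mul, hW,
      one_pow, one_mul, pow_succ, pow_mul, pow_two, hEE, one_pow, one_mul]
  have h3 := congrArg (· ^ (2 * N + 1)) h1
  simp only [mul_pow, hpow, one_pow] at h3
  refine two_dvd_of_zpow_eq_one (hEE a) (hEE b) (hEE c) (hE1 _ ha) (hE1 _ hb) (hE1 _ hc) ?_ ?_ ?_ ?_ h3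
  · rw [hmul]; exact hE1 _ hab
  · rw [hmul]; exact hE1 _ hac
  · rw [hmul]; exact hE1 _ hbc
  · rw [hmul, hmul]; exact hE1 _ habc

end Points

lemma exists_root_and_infinitesimal (m : Polynomial (ZMod 2)) (hm : m.degree ≠ 0) :
    ∃ (T : Type) (_ : CommRing T) (_ : Algebra (ZMod 2) T) (w ε : T),
      Polynomial.aeval w m = 0 ∧ ε * ε = 0 ∧ ε ≠ 0 := by
  obtain ⟨w, hw⟩ := IsAlgClosed.exists_aeval_eq_zero (AlgebraicClosure (ZMod 2)) m hm
  refine ⟨DualNumber (AlgebraicClosure (ZMod 2)), inferInstance, inferInstance,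
    algebraMap (AlgebraicClosure (ZMod 2)) _ w, DualNumber.eps, ?_, DualNumber.eps_mul_eps, ?_⟩
  · rw [Polynomial.aeval_algebraMap_apply, hw, map_zero]
  · intro h
    simpa using congrArg TrivSqZeroExt.snd h

/-! ### Verification for the four codes -/

section Codes

open Polynomial

lemma code1_cornerPoly_zero : code1.cornerPoly 0 =
    incl (X * C X) + mono (0, 0, 1) * incl (X + C X + X * C X) := by
  have h : ∀ a b c : ℤ, (AddMonoidAlgebra.single (a, b, c) 1 : Laurent) = mono (a, b, c) :=
    fun _ _ _ => rfl
  simp [CornerTable.cornerPoly, Fin.sum_univ_two, code1, CornerTable.zCorner, h, incl_X, incl_Y,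
    mul_add, ← mono_add]
  ring

lemma code1_cornerPoly_one : code1.cornerPoly 1 =
    incl (X + C X) + mono (0, 0, 1) * incl (1 + X * C X) := by
  have h : ∀ a b c : ℤ, (AddMonoidAlgebra.single (a, b, c) 1 : Laurent) = mono (a, b, c) :=
    fun _ _ _ => rfl
  simp [CornerTable.cornerPoly, Fin.sum_univ_two, code1, CornerTable.zCorner, h, incl_X, incl_Y,
    mul_add, ← mono_add]
  ring

lemma code1_eliminable : Eliminable (X * C X) (X + C X + X * C X) (X + C X)
    (1 + X * C X) where
  unit := Or.inl (by rw [map_mul, incl_X, incl_Y]; exact (isUnit_mono _).mul (isUnit_mono _))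
  prime := by
    convert code1_resultant_prime using 1
    simp only [map_add, map_sub, map_pow, map_one]
    ring
  not_dvd h := by
    -- At x = y = 1 the resultant vanishes while x, y, α and β are all 1. The same point serves for
    -- every code.
    have := map_dvd (evalBiv (1 : ZMod 2) 1) h
    simp only [monoXY, map_add, map_sub, map_mul, map_one, evalBiv_X, evalBiv_Y] at this
    revert this
    decide

lemma code1_isRigid : IsRigid (code1.cornerPoly 0) (code1.cornerPoly 1) := by
  rw [code1_cornerPoly_zero, code1_cornerPoly_one]
  refine code1_eliminable.isRigid ?_
  obtain ⟨T, _, _, w, ε, hm, hε, hε0⟩ := exists_root_and_infinitesimal (X ^ 4 + X + 1)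
    (by rw [show (X ^ 4 + X + 1 : (ZMod 2)[X]).degree = 4 by compute_degree!]; norm_num)
  have h2 := algebraMap_two_eq_zero T
  have hw : w ^ 4 = w + 1 := by
    simp only [map_add, map_pow, map_one, aeval_X] at hm
    grind
  have h9 : w ^ 9 = w ^ 3 + w := by grind
  have h13 : w ^ 13 = w ^ 3 + w ^ 2 + 1 := by grind
  -- A common zero over the field with 16 elements, where `w` satisfies w¹⁵ = 1, with a tangent
  -- vector in logarithmic coordinates. The witnesses below are the exponents of `w` giving the
  -- seven sums of tangent components.
  refine two_dvd_of_point (w := w) (ε := ε) (a := 1) (b := w ^ 3) (c := w ^ 2) (N := 7)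
    (by grind) hε hε0 1 9 13
    ⟨0, by grind⟩ ⟨3, by grind⟩ ⟨2, by grind⟩ ⟨14, by grind⟩ ⟨8, by grind⟩ ⟨6, by grind⟩ ⟨13, by grind⟩ ?_
  intro x y z hx hy hz
  simp only [map_add, map_mul, map_one, evalUnits_incl, evalUnits_mono, evalBiv_X, evalBiv_Y,
    zpow_zero, zpow_one, one_mul, hx, hy, hz]
  constructor <;> grind

lemma code2_cornerPoly_zero : code2.cornerPoly 0 =
    incl (1 + X + C X + X * C X) + mono (0, 0, 1) * incl (1 + X * C X) := by
  have h : ∀ a b c : ℤ, (AddMonoidAlgebra.single (a, b, c) 1 : Laurent) = mono (a, b, c) :=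
    fun _ _ _ => rfl
  have h0 : mono (0, 0, 0) = 1 := rfl
  simp [CornerTable.cornerPoly, Fin.sum_univ_two, code2, CornerTable.zCorner, h, h0, incl_X, incl_Y,
    mul_add, ← mono_add]
  ring

lemma code2_cornerPoly_one : code2.cornerPoly 1 =
    incl (1) + mono (0, 0, 1) * incl (X + C X + X * C X) := by
  have h : ∀ a b c : ℤ, (AddMonoidAlgebra.single (a, b, c) 1 : Laurent) = mono (a, b, c) :=
    fun _ _ _ => rfl
  have h0 : mono (0, 0, 0) = 1 := rfl
  simp [CornerTable.cornerPoly, Fin.sum_univ_two, code2, CornerTable.zCorner, h, h0, incl_X, incl_Y,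
    mul_add, ← mono_add]
  ring

lemma code2_eliminable : Eliminable (1) (X + C X + X * C X) (1 + X + C X + X * C X)
    (1 + X * C X) where
  unit := Or.inl (by simp)
  prime := by
    convert code2_resultant_prime using 1
    simp only [map_add, map_sub, map_mul, map_pow, map_one, map_ofNat]
    ring
  not_dvd h := by
    have := map_dvd (evalBiv (1 : ZMod 2) 1) h
    simp only [monoXY, map_add, map_sub, map_mul, map_one, evalBiv_X, evalBiv_Y] at this
    revert this
    decide

lemma code2_isRigid : IsRigid (code2.cornerPoly 0) (code2.cornerPoly 1) := by
  rw [code2_cornerPoly_zero, code2_cornerPoly_one]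
  -- The second component goes first: its z-free term 1 is a unit, while neither coefficient of the
  -- first component is.
  refine (code2_eliminable.isRigid ?_).symm
  obtain ⟨T, _, _, w, ε, hm, hε, hε0⟩ := exists_root_and_infinitesimal (X ^ 5 + X ^ 2 + 1)
    (by rw [show (X ^ 5 + X ^ 2 + 1 : (ZMod 2)[X]).degree = 5 by compute_degree!]; norm_num)
  have h2 := algebraMap_two_eq_zero T
  have hw : w ^ 5 = w ^ 2 + 1 := by
    simp only [map_add, map_pow, map_one, aeval_X] at hm
    grind
  have h8 : w ^ 8 = w ^ 3 + w ^ 2 + 1 := by grind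
  have h30 : w ^ 30 = w ^ 4 + w := by grind
  -- Here the point is defined over the field with 32 elements, so w³¹ = 1.
  refine two_dvd_of_point (w := w) (ε := ε) (a := 1) (b := w ^ 2 + 1) (c := w ^ 3 + w ^ 2 + w) (N := 15)
    (by grind) hε hε0 8 3 30
    ⟨0, by grind⟩ ⟨5, by grind⟩ ⟨12, by grind⟩ ⟨2, by grind⟩ ⟨23, by grind⟩ ⟨27, by grind⟩ ⟨6, by grind⟩ ?_
  intro x y z hx hy hz
  simp only [map_add, map_mul, map_one, evalUnits_incl, evalUnits_mono, evalBiv_X, evalBiv_Y,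
    zpow_zero, zpow_one, one_mul, hx, hy, hz]
  constructor <;> grind

lemma code3_cornerPoly_zero : code3.cornerPoly 0 =
    incl (X + C X + X * C X) + mono (0, 0, 1) * incl (X * C X) := by
  have h : ∀ a b c : ℤ, (AddMonoidAlgebra.single (a, b, c) 1 : Laurent) = mono (a, b, c) :=
    fun _ _ _ => rfl
  simp [CornerTable.cornerPoly, Fin.sum_univ_two, code3, CornerTable.zCorner, h, incl_X, incl_Y,
    ← mono_add]
  ring

lemma code3_cornerPoly_one : code3.cornerPoly 1 =
    incl (X + C X) + mono (0, 0, 1) * incl (1 + X + C X + X * C X) := by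
  have h : ∀ a b c : ℤ, (AddMonoidAlgebra.single (a, b, c) 1 : Laurent) = mono (a, b, c) :=
    fun _ _ _ => rfl
  simp [CornerTable.cornerPoly, Fin.sum_univ_two, code3, CornerTable.zCorner, h, incl_X, incl_Y,
    mul_add, ← mono_add]
  ring

lemma code3_eliminable : Eliminable (X + C X + X * C X) (X * C X) (X + C X)
    (1 + X + C X + X * C X) where
  unit := Or.inr (by rw [map_mul, incl_X, incl_Y]; exact (isUnit_mono _).mul (isUnit_mono _))
  prime := by
    convert code3_resultant_prime using 1
    simp only [map_add, map_sub, map_mul, map_pow, map_one, map_neg, map_ofNat]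
    ring
  not_dvd h := by
    have := map_dvd (evalBiv (1 : ZMod 2) 1) h
    simp only [monoXY, map_add, map_sub, map_mul, map_one, evalBiv_X, evalBiv_Y] at this
    revert this
    decide

lemma code3_isRigid : IsRigid (code3.cornerPoly 0) (code3.cornerPoly 1) := by
  rw [code3_cornerPoly_zero, code3_cornerPoly_one]
  refine code3_eliminable.isRigid ?_
  obtain ⟨T, _, _, w, ε, hm, hε, hε0⟩ := exists_root_and_infinitesimal (X ^ 4 + X + 1)
    (by rw [show (X ^ 4 + X + 1 : (ZMod 2)[X]).degree = 4 by compute_degree!]; norm_num)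
  have h2 := algebraMap_two_eq_zero T
  have hw : w ^ 4 = w + 1 := by
    simp only [map_add, map_pow, map_one, aeval_X] at hm
    grind
  have h8 : w ^ 8 = w ^ 2 + 1 := by grind
  refine two_dvd_of_point (w := w) (ε := ε) (a := 1) (b := w ^ 3 + w) (c := w ^ 2 + 1) (N := 7)
    (by grind) hε hε0 1 2 8
    ⟨0, by grind⟩ ⟨9, by grind⟩ ⟨8, by grind⟩ ⟨7, by grind⟩ ⟨2, by grind⟩ ⟨12, by grind⟩ ⟨11, by grind⟩ ?_
  intro x y z hx hy hz
  simp only [map_add, map_mul, map_one, evalUnits_incl, evalUnits_mono, evalBiv_X, evalBiv_Y,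
    zpow_zero, zpow_one, one_mul, hx, hy, hz]
  constructor <;> grind

lemma code4_cornerPoly_zero : code4.cornerPoly 0 =
    incl (X + X * C X) + mono (0, 0, 1) * incl (1 + X * C X) := by
  have h : ∀ a b c : ℤ, (AddMonoidAlgebra.single (a, b, c) 1 : Laurent) = mono (a, b, c) :=
    fun _ _ _ => rfl
  simp [CornerTable.cornerPoly, Fin.sum_univ_two, code4, CornerTable.zCorner, h, incl_X, incl_Y,
    mul_add, ← mono_add]
  ring

lemma code4_cornerPoly_one : code4.cornerPoly 1 =
    incl (C X) + mono (0, 0, 1) * incl (X + C X + X * C X) := by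
  have h : ∀ a b c : ℤ, (AddMonoidAlgebra.single (a, b, c) 1 : Laurent) = mono (a, b, c) :=
    fun _ _ _ => rfl
  simp [CornerTable.cornerPoly, Fin.sum_univ_two, code4, CornerTable.zCorner, h, incl_X, incl_Y,
    mul_add, ← mono_add]
  ring

lemma code4_eliminable : Eliminable (C X) (X + C X + X * C X) (X + X * C X)
    (1 + X * C X) where
  unit := Or.inl (by simpa [incl_Y] using isUnit_mono (0, 1, 0))
  prime := by
    convert code4_resultant_prime using 1
    simp only [map_add, map_sub, map_mul, map_pow, map_one, map_neg, map_ofNat]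
    ring
  not_dvd h := by
    have := map_dvd (evalBiv (1 : ZMod 2) 1) h
    simp only [monoXY, map_add, map_sub, map_mul, map_one, evalBiv_X, evalBiv_Y] at this
    revert this
    decide

lemma code4_isRigid : IsRigid (code4.cornerPoly 0) (code4.cornerPoly 1) := by
  rw [code4_cornerPoly_zero, code4_cornerPoly_one]
  -- Again the components are exchanged: the z-free term y of the second is a unit.
  refine (code4_eliminable.isRigid ?_).symm
  obtain ⟨T, _, _, w, ε, hm, hε, hε0⟩ := exists_root_and_infinitesimal (X ^ 4 + X + 1)
    (by rw [show (X ^ 4 + X + 1 : (ZMod 2)[X]).degree = 4 by compute_degree!]; norm_num)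
  have h2 := algebraMap_two_eq_zero T
  have hw : w ^ 4 = w + 1 := by
    simp only [map_add, map_pow, map_one, aeval_X] at hm
    grind
  have h7 : w ^ 7 = w ^ 3 + w + 1 := by grind
  refine two_dvd_of_point (w := w) (ε := ε) (a := w ^ 2) (b := 1) (c := w ^ 3 + w) (N := 7)
    (by grind) hε hε0 7 3 1
    ⟨2, by grind⟩ ⟨0, by grind⟩ ⟨9, by grind⟩ ⟨8, by grind⟩ ⟨11, by grind⟩ ⟨7, by grind⟩ ⟨12, by grind⟩ ?_
  intro x y z hx hy hz
  simp only [map_add, map_mul, map_one, evalUnits_incl, evalUnits_mono, evalBiv_X, evalBiv_Y,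
    zpow_zero, zpow_one, one_mul, hx, hy, hz]
  constructor <;> grind

end Codes

end CubicCode

end

theorem theorem2 :
    CubicCode.FreeOfStrings CubicCode.code1.generators ∧
    CubicCode.FreeOfStrings CubicCode.code2.generators ∧
    CubicCode.FreeOfStrings CubicCode.code3.generators ∧
    CubicCode.FreeOfStrings CubicCode.code4.generators :=
  ⟨CubicCode.CornerTable.freeOfStrings_of_isRigid CubicCode.code1_isRigid,
    CubicCode.CornerTable.freeOfStrings_of_isRigid CubicCode.code2_isRigid,
    CubicCode.CornerTable.freeOfStrings_of_isRigid CubicCode.code3_isRigid,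
    CubicCode.CornerTable.freeOfStrings_of_isRigid CubicCode.code4_isRigid⟩
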